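/- For a graph $G$ and a fixed graph $H$, a subgraph copy of $H$ in $G$ is a subgraph of $G$ isomorphic to $H$, and an induced copy of $H$ in $G$ is a set $S$ of vertices of $G$ such that the subgraph of $G$ induced on $S$ is isomorphic to $H$. $G(n,p)$ is the random graph on $n$ labelled vertices in which each pair of distinct vertices is an edge independently with probability $p$. 1. Let $H=K_2+K_2$ be the disjoint union of two edges, and fix $p\in(0,1)$. Let $X_H$ be the number of subgraph copies of $H$ in $G(n,p)$, and let $\sigma_H=\sigma_H(n,p)$ be the standard deviation of $X_H$. There is a constant $c=c(p)>0$ such that for all $n\ge 4$ we have $\sigma_H>0$ and $$\sup_{x}\mathbb P[X_H=x]\ \ge\ c\,n^{1/2}\,\sigma_H^{-1}.$$ 2. There are a graph $H'$ on $64$ vertices and a constant $c>0$ such that, if $X_{H'}$ denotes the number of induced copies of $H'$ in $G(n,1/2)$ and $\sigma_{H'}=\sigma_{H'}(n)$ its standard deviation, then for all $n\ge 64$ we have $\sigma_{H'}>0$ and $$\sup_{x}\mathbb P[X_{H'}=x]\ \ge\ c\,n^{1/2}\,\sigma_{H'}^{-1}.$$ -/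

import Mathlib

open MeasureTheory ProbabilityTheory

noncomputable section

/-- The disjoint union of two edges. -/
abbrev twoDisjointEdges : SimpleGraph (Fin 2 ⊕ Fin 2) :=
  (⊤ : SimpleGraph (Fin 2)) ⊕g (⊤ : SimpleGraph (Fin 2))

open scoped Classical in
/-- The number of induced copies of `H` in `G`: the number of vertex sets `S` such that the
subgraph of `G` induced on `S` is isomorphic to `H`. -/
def inducedCopyCount {V W : Type*} [Fintype V] (G : SimpleGraph V) (H : SimpleGraph W) : ℕ :=
  (Finset.univ.filter fun S : Finset V => Nonempty (H ≃g G.induce (S : Set V))).card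

/-- The standard deviation of a real random variable. -/
def stdDev {Ω : Type*} [MeasurableSpace Ω] (μ : Measure Ω) (X : Ω → ℝ) : ℝ :=
  √(variance X μ)

/-- The largest point probability `sup_x P[X = x]` of a real random variable. -/
def maxPointProb {Ω : Type*} [MeasurableSpace Ω] (μ : Measure Ω) (X : Ω → ℝ) : ℝ :=
  ⨆ x : ℝ, μ.real {ω | X ω = x}

/-- The random graph `G(n, p)`: each of the pairs of distinct elements of `Fin n` is an edge
independently with probability `p`. -/
abbrev gnp (n : ℕ) (p : unitInterval) : Measure (SimpleGraph (Fin n)) :=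
  SimpleGraph.binomialRandom (Fin n) p

/-- The number `1 / 2` as an edge probability. -/
def halfProb : unitInterval := ⟨1 / 2, by norm_num, by norm_num⟩

/-- The number of (not necessarily induced) subgraphs of `G(n, p)` isomorphic to two disjoint
edges, as a random variable. -/
def twoEdgesCount (n : ℕ) (G : SimpleGraph (Fin n)) : ℝ := (G.copyCount twoDisjointEdges : ℝ)

/-- The number of induced copies of `H` in `G(n, p)`, as a random variable. -/
def inducedCount {W : Type*} (H : SimpleGraph W) (n : ℕ) (G : SimpleGraph (Fin n)) : ℝ :=
  (inducedCopyCount G H : ℝ)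

end

/-! Both counts are sums over `k`-sets `S` of a bounded statistic of the graph inside `S`, with `k =
4` or `k = 64`. Expand such a sum in products of centred edge indicators. Suppose that, among the
products living on at most four vertices, only the constant, the single edges and the pairs of
disjoint edges occur (`IsLocalStat`). Then the count is a constant, plus a multiple of order `n ^ (k
- 2)` of the centred edge number `L`, plus a multiple of order `n ^ (k - 4)` of the sum `D` over
disjoint pairs, plus a residual. Residuals of two sets are orthogonal unless the sets share five
vertices, so the total residual has second moment `O(n ^ (2 * k - 5))`.

The point is that `L ^ 2` equals `D` plus a sum over adjacent pairs plus an affine function of `L`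
(`linSum_sq`), and the adjacent sum has second moment only `O(n ^ 3)`. Hence the count is a function
of the number of edges up to an error of order `n ^ (k - 5 / 2)`. The number of edges is
concentrated on `O(n)` values, so `O(n ^ (k - 3 / 2))` integers carry a constant share of the mass,
and one of them has probability of order at least `n ^ (-(k - 3 / 2))` (`exists_bexp_eq_ge`). The
linear term makes the standard deviation at least of order `n ^ (k - 1)`, so this probability beats
the order of the reciprocal standard deviation by `√n` (`IsLocalStat.exists_pointProb_ge`).

For two disjoint edges the expansion is exact algebra on a `4`-set (`matchingCount_eq`). For induced
copies with `p = 1 / 2`, conditioning on the graph on four vertices reduces the hypothesis to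
counting labelled four-vertex patterns in `H'` (`isLocalStat_inducedIndicator`). The explicit graph
`balancedGraph` has the required counts by kernel computation (`packedCounts_eq`,
`sum_codeCount_matrixCode`). -/

/-- `f` depends only on the coordinates in `B`. -/
def DependsOnCoords {ι : Type*} (B : Finset ι) (f : (ι → Bool) → ℝ) : Prop :=
  ∀ ω ω', (∀ i ∈ B, ω i = ω' i) → f ω = f ω'

lemma DependsOnCoords.piecewise {ι : Type*} [DecidableEq ι] {B : Finset ι} {f : (ι → Bool) → ℝ}
    (h : DependsOnCoords B f)
    (ω η : ι → Bool) : f (B.piecewise ω η) = f ω :=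
  h _ _ fun i hi => by simp [hi]

lemma DependsOnCoords.mono {ι : Type*} {B C : Finset ι} (hBC : B ⊆ C) {f : (ι → Bool) → ℝ}
    (h : DependsOnCoords B f) : DependsOnCoords C f :=
  fun ω ω' hh => h ω ω' fun i hi => hh i (hBC hi)

lemma DependsOnCoords.mul {ι : Type*} [DecidableEq ι] {B C : Finset ι} {f g : (ι → Bool) → ℝ}
    (hf : DependsOnCoords B f) (hg : DependsOnCoords C g) :
    DependsOnCoords (B ∪ C) (fun ω => f ω * g ω) := fun ω ω' hh => by
  show f ω * g ω = f ω' * g ω'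
  rw [hf ω ω' fun i hi => hh i (Finset.mem_union_left _ hi),
    hg ω ω' fun i hi => hh i (Finset.mem_union_right _ hi)]

lemma dependsOn_coord {ι : Type*} (i : ι) (F : Bool → ℝ) :
    DependsOnCoords {i} (fun ω : ι → Bool => F (ω i)) := fun ω ω' h => by
  simp [h i (Finset.mem_singleton_self i)]

lemma dependsOn_prod {ι κ : Type*} [DecidableEq ι] (s : Finset κ) (j : κ → ι)
    (F : κ → Bool → ℝ) :
    DependsOnCoords (s.image j) (fun ω : ι → Bool => ∏ k ∈ s, F k (ω (j k))) := fun ω ω' h =>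
  Finset.prod_congr rfl fun k hk => by rw [h _ (Finset.mem_image_of_mem j hk)]

/-! ### Expectation over independent Bernoulli coordinates. -/

section BernoulliExpectation

variable {ι : Type*} [Fintype ι] [DecidableEq ι]

/-- The weight of a single Bernoulli outcome. -/
def bernWeight (p : ℝ) (b : Bool) : ℝ := cond b p (1 - p)

lemma sum_bernWeight (p : ℝ) : ∑ b, bernWeight p b = 1 := by simp [bernWeight]

lemma bernWeight_nonneg {p : ℝ} (h0 : 0 ≤ p) (h1 : p ≤ 1) (b : Bool) : 0 ≤ bernWeight p b := by
  cases b <;> simp [bernWeight, h0, h1]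

/-- The expectation of `f` under independent Bernoulli variables with parameter `p`. -/
def bexp (p : ℝ) (f : (ι → Bool) → ℝ) : ℝ := ∑ ω, (∏ i, bernWeight p (ω i)) * f ω

lemma bexp_prod (p : ℝ) (φ : ι → Bool → ℝ) :
    bexp p (fun ω => ∏ i, φ i (ω i)) = ∏ i, ∑ b, bernWeight p b * φ i b := by
  rw [Finset.prod_univ_sum, Fintype.piFinset_univ]
  simp only [bexp, Finset.prod_mul_distrib]

lemma bexp_const (p c : ℝ) : bexp p (fun _ : ι → Bool => c) = c := by
  have h := bexp_prod (ι := ι) p (fun _ _ => 1)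
  simp only [mul_one, sum_bernWeight, Finset.prod_const_one] at h
  have : bexp p (fun _ : ι → Bool => c) = bexp p (fun _ : ι → Bool => 1) * c := by
    simp only [bexp, Finset.sum_mul, mul_one]
  rw [this, h, one_mul]

lemma bexp_add (p : ℝ) (f g : (ι → Bool) → ℝ) :
    bexp p (fun ω => f ω + g ω) = bexp p f + bexp p g := by
  simp only [bexp, mul_add, Finset.sum_add_distrib]

lemma bexp_sub (p : ℝ) (f g : (ι → Bool) → ℝ) :
    bexp p (fun ω => f ω - g ω) = bexp p f - bexp p g := by
  simp only [bexp, mul_sub, Finset.sum_sub_distrib]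

lemma bexp_const_mul (p c : ℝ) (f : (ι → Bool) → ℝ) :
    bexp p (fun ω => c * f ω) = c * bexp p f := by
  simp only [bexp, Finset.mul_sum]
  exact Finset.sum_congr rfl fun _ _ => by ring

lemma bexp_mul_const (p c : ℝ) (f : (ι → Bool) → ℝ) :
    bexp p (fun ω => f ω * c) = bexp p f * c := by
  simp only [bexp, Finset.sum_mul, mul_assoc]

lemma bexp_sum {κ : Type*} (p : ℝ) (s : Finset κ) (f : κ → (ι → Bool) → ℝ) :
    bexp p (fun ω => ∑ k ∈ s, f k ω) = ∑ k ∈ s, bexp p (f k) := by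
  simp only [bexp, Finset.mul_sum]
  exact Finset.sum_comm

lemma bexp_mono {p : ℝ} (h0 : 0 ≤ p) (h1 : p ≤ 1) {f g : (ι → Bool) → ℝ} (h : ∀ ω, f ω ≤ g ω) :
    bexp p f ≤ bexp p g :=
  Finset.sum_le_sum fun ω _ => mul_le_mul_of_nonneg_left (h ω)
    (Finset.prod_nonneg fun _ _ => bernWeight_nonneg h0 h1 _)

lemma bexp_nonneg {p : ℝ} (h0 : 0 ≤ p) (h1 : p ≤ 1) {f : (ι → Bool) → ℝ} (h : ∀ ω, 0 ≤ f ω) :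
    0 ≤ bexp p f := by
  simpa [bexp_const] using bexp_mono h0 h1 (f := fun _ => 0) h

/-- Resampling the coordinates outside `B` does not change expectations. -/
lemma bexp_piecewise (p : ℝ) (B : Finset ι) (F : (ι → Bool) → ℝ) :
    bexp p F = bexp p (fun ω => bexp p (fun η => F (B.piecewise ω η))) := by
  set W : (ι → Bool) → ℝ := fun ω => ∏ i, bernWeight p (ω i) with hW
  have e1 : bexp p F = ∑ z : (ι → Bool) × (ι → Bool), W z.1 * W z.2 * F z.1 := by
    have := bexp_const (ι := ι) p 1
    simp only [bexp, mul_one] at this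
    rw [Fintype.sum_prod_type]
    refine Finset.sum_congr rfl fun ω _ => ?_
    simp only [← Finset.sum_mul, ← Finset.mul_sum]
    simp [hW, this]
  -- Two independent copies exchange their coordinates outside `B`; this involution preserves the
  -- product weight.
  let swap : (ι → Bool) × (ι → Bool) → (ι → Bool) × (ι → Bool) :=
    fun z => (B.piecewise z.1 z.2, B.piecewise z.2 z.1)
  have hs : Function.Involutive swap := by
    rintro ⟨a, b⟩
    simp only [swap, Prod.mk.injEq]
    constructor <;> ext i <;> by_cases hi : i ∈ B <;> simp [hi]
  have e2 : bexp p F = ∑ z : (ι → Bool) × (ι → Bool),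
      W z.1 * W z.2 * F (B.piecewise z.1 z.2) := by
    rw [e1, ← Equiv.sum_comp hs.toPerm]
    refine Finset.sum_congr rfl fun z _ => ?_
    simp only [Function.Involutive.coe_toPerm, swap, hW, ← Finset.prod_mul_distrib]
    congr 1
    refine Finset.prod_congr rfl fun i _ => ?_
    by_cases hi : i ∈ B <;> simp [hi, mul_comm]
  rw [e2, Fintype.sum_prod_type]
  refine Finset.sum_congr rfl fun ω _ => ?_
  simp only [bexp, Finset.mul_sum, hW]
  exact Finset.sum_congr rfl fun _ _ => by ring

/-- Condition on the coordinates in `B`: there `f` is a constant factor and `h` averages to zero.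
All later orthogonality of residuals comes from this. -/
lemma bexp_mul_eq_zero {p : ℝ} {B : Finset ι} {h f : (ι → Bool) → ℝ} (hf : DependsOnCoords B f)
    (hh : ∀ ω, bexp p (fun η => h (B.piecewise ω η)) = 0) : bexp p (fun ω => h ω * f ω) = 0 := by
  rw [bexp_piecewise p B]
  simp only [hf.piecewise, bexp_mul_const, hh, zero_mul, bexp_const]

lemma bexp_mul_of_disjoint {p : ℝ} {B C : Finset ι} (hBC : Disjoint B C) {f g : (ι → Bool) → ℝ}
    (hf : DependsOnCoords B f) (hg : DependsOnCoords C g) :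
    bexp p (fun ω => f ω * g ω) = bexp p f * bexp p g := by
  rw [bexp_piecewise p B]
  have hg' : ∀ ω η, g (B.piecewise ω η) = g η := fun ω η => hg _ _ fun i hi => by
    have : i ∉ B := fun h => (Finset.disjoint_left.1 hBC h) hi
    simp [this]
  simp only [hf.piecewise, hg', bexp_const_mul, bexp_mul_const]

lemma bexp_coord (p : ℝ) (i : ι) (F : Bool → ℝ) :
    bexp p (fun ω => F (ω i)) = p * F true + (1 - p) * F false := by
  have h := bexp_prod p (fun j b => if j = i then F b else 1)
  have e : ∀ ω : ι → Bool, (∏ j, if j = i then F (ω j) else 1) = F (ω i) := fun ω => by simp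
  simp only [e] at h
  rw [h, Finset.prod_eq_single i]
  · simp [bernWeight]
  · intro j _ hj; simp [hj, bernWeight]
  · simp

lemma bexp_prod_comp {κ : Type*} [DecidableEq κ] (p : ℝ) (s : Finset κ) (j : κ → ι)
    (hj : Set.InjOn j s) (F : κ → Bool → ℝ) :
    bexp p (fun ω => ∏ k ∈ s, F k (ω (j k))) =
      ∏ k ∈ s, (p * F k true + (1 - p) * F k false) := by
  induction s using Finset.induction_on with
  | empty => simp [bexp_const]
  | insert a s ha ih =>
    simp only [Finset.prod_insert ha]
    rw [← ih (hj.mono (by simp)), ← bexp_coord p (j a) (F a)]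
    refine bexp_mul_of_disjoint ?_ (dependsOn_coord (j a) (F a)) (dependsOn_prod s j F)
    simp only [Finset.disjoint_singleton_left, Finset.mem_image, not_exists, not_and]
    intro k hk hka
    have := hj (by simp [hk]) (by simp) hka
    exact ha (this ▸ hk)

/-- Markov's inequality for a square. -/
lemma bexp_indicator_le {p : ℝ} (h0 : 0 ≤ p) (h1 : p ≤ 1) (f : (ι → Bool) → ℝ) {A : ℝ}
    (hA : 0 < A) (hf : bexp p (fun ω => f ω ^ 2) ≤ A ^ 2) :
    bexp p (fun ω => if 2 * A < |f ω| then 1 else 0) ≤ 1 / 4 := by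
  have : bexp p (fun ω => if 2 * A < |f ω| then 1 else 0) ≤
      bexp p (fun ω => f ω ^ 2 * (1 / (4 * A ^ 2))) := by
    refine bexp_mono h0 h1 fun ω => ?_
    split_ifs with h
    · rw [mul_one_div, le_div_iff₀ (by positivity), ← sq_abs (f ω)]
      nlinarith
    · positivity
  rw [bexp_mul_const] at this
  refine this.trans ?_
  rw [mul_one_div, div_le_iff₀ (by positivity)]
  linarith

/-- The Cauchy–Schwarz inequality. -/
lemma bexp_mul_sq_le {p : ℝ} (h0 : 0 ≤ p) (h1 : p ≤ 1) (f g : (ι → Bool) → ℝ) :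
    bexp p (fun ω => f ω * g ω) ^ 2 ≤
      bexp p (fun ω => f ω ^ 2) * bexp p (fun ω => g ω ^ 2) := by
  have h := discrim_le_zero (a := bexp p (fun ω => g ω ^ 2))
    (b := 2 * bexp p (fun ω => f ω * g ω)) (c := bexp p (fun ω => f ω ^ 2)) fun t => by
      have : 0 ≤ bexp p (fun ω => (f ω + t * g ω) ^ 2) := bexp_nonneg h0 h1 fun _ => sq_nonneg _
      have e : (fun ω => (f ω + t * g ω) ^ 2) =
          fun ω => (t * t) * g ω ^ 2 + t * (2 * (f ω * g ω)) + f ω ^ 2 := by ext; ring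
      rw [e, bexp_add, bexp_add, bexp_const_mul, bexp_const_mul, bexp_const_mul] at this
      linarith
  rw [discrim] at h
  linarith

end BernoulliExpectation

/-! ### Large point probabilities from concentration. -/

section PointProbability

variable {ι : Type*} [Fintype ι] [DecidableEq ι]

/-- An interval of length `4 * r` holds at most `4 * r + 1` integers, and `1 ≤ r` absorbs the extra
one. -/
lemma card_Icc_ceil_floor_le (u : ℝ) {r : ℝ} (hr : 1 ≤ r) :
    ((Finset.Icc ⌈u - 2 * r⌉ ⌊u + 2 * r⌋).card : ℝ) ≤ 5 * r := by
  rw [Int.card_Icc]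
  have h1 := Int.floor_le (u + 2 * r)
  have h2 := Int.le_ceil (u - 2 * r)
  have h : (((⌊u + 2 * r⌋ + 1 - ⌈u - 2 * r⌉).toNat : ℤ) : ℝ) =
      ((max (⌊u + 2 * r⌋ + 1 - ⌈u - 2 * r⌉) 0 : ℤ) : ℝ) := by
    rw [Int.toNat_eq_max]
  have h' : ((⌊u + 2 * r⌋ + 1 - ⌈u - 2 * r⌉).toNat : ℝ) =
      ((max (⌊u + 2 * r⌋ + 1 - ⌈u - 2 * r⌉) 0 : ℤ) : ℝ) := by exact_mod_cast h
  rw [h', Int.cast_max]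
  refine max_le ?_ (by push_cast; linarith)
  push_cast
  linarith

/-- If `m` is concentrated at scale `B` and `X` is concentrated at scale `A` around a function of
`m`, then the integer variable `X` has a value of probability of order `1 / (A * B)`. -/
lemma exists_bexp_eq_ge {p : ℝ} (h0 : 0 ≤ p) (h1 : p ≤ 1) (X : (ι → Bool) → ℤ)
    (m : (ι → Bool) → ℕ) (μ : ℝ) (f : ℕ → ℝ) {A B : ℝ} (hA : 1 ≤ A) (hB : 1 ≤ B)
    (hm : bexp p (fun ω => ((m ω : ℝ) - μ) ^ 2) ≤ B ^ 2)
    (hX : bexp p (fun ω => ((X ω : ℝ) - f (m ω)) ^ 2) ≤ A ^ 2) :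
    ∃ x : ℤ, 1 / (100 * (A * B)) ≤ bexp p (fun ω => if X ω = x then 1 else 0) := by
  by_contra! hcon
  -- `T` has at most `5 * B * (5 * A)` elements and contains `X` outside two events of probability
  -- at most `1 / 4` each. If every value had probability below `1 / (100 * (A * B))`, then `T`
  -- would carry at most `1 / 4`, and the total would be at most `3 / 4`.
  set T : Finset ℤ := (Finset.Icc ⌈μ - 2 * B⌉ ⌊μ + 2 * B⌋).biUnion fun j =>
    Finset.Icc ⌈f j.toNat - 2 * A⌉ ⌊f j.toNat + 2 * A⌋ with hT
  have hcard : (T.card : ℝ) ≤ 25 * (A * B) := by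
    calc (T.card : ℝ) ≤ ∑ j ∈ Finset.Icc ⌈μ - 2 * B⌉ ⌊μ + 2 * B⌋,
          ((Finset.Icc ⌈f j.toNat - 2 * A⌉ ⌊f j.toNat + 2 * A⌋).card : ℝ) := by
          exact_mod_cast Finset.card_biUnion_le
      _ ≤ ∑ j ∈ Finset.Icc ⌈μ - 2 * B⌉ ⌊μ + 2 * B⌋, 5 * A :=
          Finset.sum_le_sum fun j _ => card_Icc_ceil_floor_le _ hA
      _ ≤ (5 * B) * (5 * A) := by
          rw [Finset.sum_const, nsmul_eq_mul]
          exact mul_le_mul_of_nonneg_right (card_Icc_ceil_floor_le μ hB) (by linarith)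
      _ = _ := by ring
  have key : ∀ ω, (1 : ℝ) ≤ ((if 2 * B < |(m ω : ℝ) - μ| then 1 else 0) +
      (if 2 * A < |(X ω : ℝ) - f (m ω)| then 1 else 0)) +
      ∑ x ∈ T, (if X ω = x then 1 else 0) := by
    intro ω
    have hs : 0 ≤ ∑ x ∈ T, (if X ω = x then (1 : ℝ) else 0) :=
      Finset.sum_nonneg fun _ _ => by split_ifs <;> norm_num
    by_cases c1 : 2 * B < |(m ω : ℝ) - μ|
    · rw [if_pos c1]; split_ifs <;> linarith
    by_cases c2 : 2 * A < |(X ω : ℝ) - f (m ω)|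
    · rw [if_pos c2]; split_ifs <;> linarith
    rw [if_neg c1, if_neg c2, Finset.sum_ite_eq, if_pos]
    · norm_num
    rw [not_lt, abs_le] at c1 c2
    rw [hT, Finset.mem_biUnion]
    refine ⟨(m ω : ℤ), ?_, ?_⟩
    · rw [Finset.mem_Icc, Int.ceil_le, Int.le_floor]
      push_cast
      constructor <;> linarith [c1.1, c1.2]
    · rw [Finset.mem_Icc, Int.ceil_le, Int.le_floor, Int.toNat_natCast]
      constructor <;> linarith [c2.1, c2.2]
  have hexp := bexp_mono h0 h1 key
  rw [bexp_const, bexp_add, bexp_add, bexp_sum] at hexp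
  have e1 := bexp_indicator_le h0 h1 (fun ω => (m ω : ℝ) - μ) (by linarith) hm
  have e2 := bexp_indicator_le h0 h1 (fun ω => (X ω : ℝ) - f (m ω)) (by linarith) hX
  have e3 : ∑ x ∈ T, bexp p (fun ω => if X ω = x then (1 : ℝ) else 0) ≤
      T.card * (1 / (100 * (A * B))) := by
    rw [← nsmul_eq_mul, ← Finset.sum_const]
    exact Finset.sum_le_sum fun x _ => (hcon x).le
  have hAB : 0 < A * B := by positivity
  have e4 : (T.card : ℝ) * (1 / (100 * (A * B))) ≤ 1 / 4 := by
    rw [mul_one_div, div_le_iff₀ (by positivity)]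
    linarith
  linarith

/-- The variance under independent Bernoulli variables. -/
def bvar (p : ℝ) (X : (ι → Bool) → ℝ) : ℝ := bexp p (fun ω => (X ω - bexp p X) ^ 2)

/-- Cauchy–Schwarz for `X` minus its mean, which changes nothing on the left because `M` is centred.
With `M` the centred edge number it bounds the variance from below. -/
lemma bexp_mul_sq_le_bvar_mul {p : ℝ} (h0 : 0 ≤ p) (h1 : p ≤ 1) (X M : (ι → Bool) → ℝ)
    (hM : bexp p M = 0) :
    bexp p (fun ω => X ω * M ω) ^ 2 ≤ bvar p X * bexp p (fun ω => M ω ^ 2) := by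
  have := bexp_mul_sq_le h0 h1 (fun ω => X ω - bexp p X) M
  simp only [sub_mul, bexp_sub, bexp_const_mul, hM, mul_zero, sub_zero] at this
  exact this

end PointProbability

/-! ### Linear and quadratic sums of centred edge indicators. -/

section EdgeSums

variable {V : Type*} [Fintype V] [DecidableEq V]

/-- The pairs of distinct elements of `S`. -/
def edgesIn {V : Type*} [DecidableEq V] (S : Finset V) : Finset (Sym2 V) :=
  S.sym2.filter fun e => ¬ e.IsDiag

lemma mem_edgesIn {V : Type*} [DecidableEq V] {S : Finset V} {e : Sym2 V} :
    e ∈ edgesIn S ↔ e.toFinset ⊆ S ∧ ¬ e.IsDiag := by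
  simp [edgesIn, Finset.mem_sym2_iff, Finset.subset_iff, Sym2.mem_toFinset]

lemma edgesIn_mono {V : Type*} [DecidableEq V] {S T : Finset V} (h : S ⊆ T) :
    edgesIn S ⊆ edgesIn T := fun e he => by
  rw [mem_edgesIn] at he ⊢
  exact ⟨he.1.trans h, he.2⟩

lemma card_edgesIn_le {V : Type*} [DecidableEq V] (S : Finset V) :
    (edgesIn S).card ≤ S.card ^ 2 := by
  refine (Finset.card_filter_le _ _).trans ?_
  rw [Finset.sym2_eq_image, pow_two, ← Finset.card_product]
  exact Finset.card_image_le

lemma card_edgesIn_pos {V : Type*} [DecidableEq V] {S : Finset V} (h : 2 ≤ S.card) :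
    0 < (edgesIn S).card := by
  obtain ⟨a, ha, b, hb, hab⟩ := Finset.one_lt_card.1 h
  exact Finset.card_pos.2 ⟨s(a, b), by
    rw [mem_edgesIn, Sym2.toFinset_mk_eq]; simp [Finset.insert_subset_iff, ha, hb, hab]⟩

/-- Ordered pairs of disjoint edges inside `S`. -/
def disjPairs {V : Type*} [DecidableEq V] (S : Finset V) : Finset (Sym2 V × Sym2 V) :=
  (edgesIn S ×ˢ edgesIn S).filter fun q => Disjoint q.1.toFinset q.2.toFinset

/-- Ordered pairs of distinct edges inside `S` that share a vertex. -/
def adjPairs {V : Type*} [DecidableEq V] (S : Finset V) : Finset (Sym2 V × Sym2 V) :=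
  (edgesIn S ×ˢ edgesIn S).filter fun q => q.1 ≠ q.2 ∧ ¬ Disjoint q.1.toFinset q.2.toFinset

lemma mem_disjPairs {V : Type*} [DecidableEq V] {S : Finset V} {q : Sym2 V × Sym2 V} :
    q ∈ disjPairs S ↔ (q.1 ∈ edgesIn S ∧ q.2 ∈ edgesIn S) ∧
      Disjoint q.1.toFinset q.2.toFinset := by
  simp [disjPairs]

lemma mem_adjPairs {V : Type*} [DecidableEq V] {S : Finset V} {q : Sym2 V × Sym2 V} :
    q ∈ adjPairs S ↔ (q.1 ∈ edgesIn S ∧ q.2 ∈ edgesIn S) ∧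
      q.1 ≠ q.2 ∧ ¬ Disjoint q.1.toFinset q.2.toFinset := by
  simp [adjPairs]

lemma ne_of_disjoint_toFinset {V : Type*} [DecidableEq V] {e f : Sym2 V}
    (h : Disjoint e.toFinset f.toFinset) : e ≠ f := by
  rintro rfl
  exact Sym2.toFinset_ne_empty e (disjoint_self.1 h)

/-- The centred indicator of a coordinate. -/
def centred {ι : Type*} (p : ℝ) (ω : ι → Bool) (e : ι) : ℝ := cond (ω e) 1 0 - p

lemma abs_centred_le {ι : Type*} {p : ℝ} (h0 : 0 ≤ p) (h1 : p ≤ 1) (ω : ι → Bool) (e : ι) :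
    |centred p ω e| ≤ 1 := by
  rw [abs_le]
  cases h : ω e <;> simp only [centred, h, cond_true, cond_false] <;> constructor <;> linarith

lemma centred_sq {ι : Type*} (p : ℝ) (ω : ι → Bool) (e : ι) :
    centred p ω e ^ 2 = (1 - 2 * p) * centred p ω e + p * (1 - p) := by
  cases h : ω e <;> simp only [centred, h, cond_true, cond_false] <;> ring

lemma bexp_centred {ι : Type*} [Fintype ι] [DecidableEq ι] (p : ℝ) (e : ι) :
    bexp p (fun ω => centred p ω e) = 0 := by
  have := bexp_coord p e (fun b => cond b 1 0 - p)
  simp only [cond_true, cond_false] at this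
  simp only [centred, this]
  ring

lemma dependsOn_centred {ι : Type*} (p : ℝ) (e : ι) :
    DependsOnCoords {e} (fun ω => centred p ω e) :=
  dependsOn_coord e (fun b => cond b 1 0 - p)

lemma bexp_centred_mul {ι : Type*} [Fintype ι] [DecidableEq ι] (p : ℝ) {e : ι} {B : Finset ι}
    (he : e ∉ B) {f : (ι → Bool) → ℝ} (hf : DependsOnCoords B f) :
    bexp p (fun ω => centred p ω e * f ω) = 0 := by
  rw [bexp_mul_of_disjoint (Finset.disjoint_singleton_left.2 he) (dependsOn_centred p e) hf,
    bexp_centred, zero_mul]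

/-- The sum of the centred edge indicators inside `S`. -/
def linSum {V : Type*} [DecidableEq V] (p : ℝ) (S : Finset V) (ω : Sym2 V → Bool) : ℝ :=
  ∑ e ∈ edgesIn S, centred p ω e

/-- The sum over ordered disjoint pairs of edges inside `S` of the product of the centred
indicators. -/
def disjSum {V : Type*} [DecidableEq V] (p : ℝ) (S : Finset V) (ω : Sym2 V → Bool) : ℝ :=
  ∑ q ∈ disjPairs S, centred p ω q.1 * centred p ω q.2

/-- The sum over ordered adjacent pairs of edges inside `S` of the product of the centred
indicators. -/
def adjSum {V : Type*} [DecidableEq V] (p : ℝ) (S : Finset V) (ω : Sym2 V → Bool) : ℝ :=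
  ∑ q ∈ adjPairs S, centred p ω q.1 * centred p ω q.2

/-- An ordered pair of edges is disjoint, adjacent or equal, and `centred_sq` linearises the equal
pairs. This trades `disjSum` for a function of the edge number, at the cost of the smaller `adjSum`.
-/
lemma linSum_sq {V : Type*} [DecidableEq V] (p : ℝ) (S : Finset V) (ω : Sym2 V → Bool) :
    linSum p S ω ^ 2 = disjSum p S ω + adjSum p S ω +
      ((1 - 2 * p) * linSum p S ω + (edgesIn S).card * (p * (1 - p))) := by
  have h1 : (1 - 2 * p) * linSum p S ω + (edgesIn S).card * (p * (1 - p)) =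
      ∑ q ∈ edgesIn S ×ˢ edgesIn S,
        if q.1 = q.2 then centred p ω q.1 * centred p ω q.2 else 0 := by
    rw [Finset.sum_product]
    simp only [Finset.sum_ite_eq, linSum, Finset.mul_sum]
    rw [← nsmul_eq_mul, ← Finset.sum_const, ← Finset.sum_add_distrib]
    refine Finset.sum_congr rfl fun e he => ?_
    rw [if_pos he, ← centred_sq, sq]
  rw [h1, sq, linSum, Finset.sum_mul_sum, ← Finset.sum_product', disjSum, adjSum, disjPairs,
    adjPairs, Finset.sum_filter, Finset.sum_filter, ← Finset.sum_add_distrib,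
    ← Finset.sum_add_distrib]
  refine Finset.sum_congr rfl fun q _ => ?_
  by_cases hd : Disjoint q.1.toFinset q.2.toFinset
  · simp [hd, ne_of_disjoint_toFinset hd]
  · by_cases he : q.1 = q.2 <;> simp [hd, he]

lemma abs_linSum_le {V : Type*} [DecidableEq V] {p : ℝ} (h0 : 0 ≤ p) (h1 : p ≤ 1)
    (S : Finset V) (ω : Sym2 V → Bool) :
    |linSum p S ω| ≤ (S.card : ℝ) ^ 2 := by
  refine (Finset.abs_sum_le_sum_abs _ _).trans ?_
  refine (Finset.sum_le_card_nsmul _ _ 1 fun e _ => abs_centred_le h0 h1 ω e).trans ?_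
  rw [nsmul_eq_mul, mul_one]
  exact_mod_cast card_edgesIn_le S

lemma abs_disjSum_le {V : Type*} [DecidableEq V] {p : ℝ} (h0 : 0 ≤ p) (h1 : p ≤ 1)
    (S : Finset V) (ω : Sym2 V → Bool) :
    |disjSum p S ω| ≤ (S.card : ℝ) ^ 4 := by
  refine (Finset.abs_sum_le_sum_abs _ _).trans ?_
  refine (Finset.sum_le_card_nsmul _ _ 1 fun q _ => ?_).trans ?_
  · rw [abs_mul]
    exact mul_le_one₀ (abs_centred_le h0 h1 ω _) (abs_nonneg _) (abs_centred_le h0 h1 ω _)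
  rw [nsmul_eq_mul, mul_one]
  have : (disjPairs S).card ≤ S.card ^ 4 := by
    refine (Finset.card_filter_le _ _).trans ?_
    rw [Finset.card_product]
    calc _ ≤ S.card ^ 2 * S.card ^ 2 := Nat.mul_le_mul (card_edgesIn_le S) (card_edgesIn_le S)
      _ = _ := by ring
  exact_mod_cast this

lemma dependsOn_linSum {V : Type*} [DecidableEq V] (p : ℝ) (S : Finset V) :
    DependsOnCoords (edgesIn S) (linSum p S) :=
  fun ω ω' h => Finset.sum_congr rfl fun e he => by simp only [centred, h e he]

lemma dependsOn_disjSum {V : Type*} [DecidableEq V] (p : ℝ) (S : Finset V) :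
    DependsOnCoords (edgesIn S) (disjSum p S) :=
  fun ω ω' h => Finset.sum_congr rfl fun q hq => by
    have := (mem_disjPairs.1 hq).1
    simp only [centred, h _ this.1, h _ this.2]

/-- Averaging over the coordinates outside `B` kills every centred factor that is not in `B`; so
`linSum` and `disjSum` over `S` project to the same sums over a subset. -/
lemma bexp_centred_piecewise (p : ℝ) (B : Finset (Sym2 V)) (ω : Sym2 V → Bool) (e : Sym2 V) :
    bexp p (fun η => centred p (B.piecewise ω η) e) = if e ∈ B then centred p ω e else 0 := by
  split_ifs with h
  · simp [centred, h, bexp_const]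
  · simpa [centred, h] using bexp_centred p e

lemma bexp_centred_mul_piecewise (p : ℝ) (B : Finset (Sym2 V)) (ω : Sym2 V → Bool)
    {e f : Sym2 V} (hef : e ≠ f) :
    bexp p (fun η => centred p (B.piecewise ω η) e * centred p (B.piecewise ω η) f) =
      if e ∈ B ∧ f ∈ B then centred p ω e * centred p ω f else 0 := by
  have h1 : DependsOnCoords {e} (fun η => centred p (B.piecewise ω η) e) := fun η η' h => by
    by_cases he : e ∈ B <;> simp [centred, he, h e (Finset.mem_singleton_self e)]
  have h2 : DependsOnCoords {f} (fun η => centred p (B.piecewise ω η) f) := fun η η' h => by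
    by_cases he : f ∈ B <;> simp [centred, he, h f (Finset.mem_singleton_self f)]
  rw [bexp_mul_of_disjoint (by simpa using hef) h1 h2, bexp_centred_piecewise,
    bexp_centred_piecewise]
  by_cases he : e ∈ B <;> by_cases hf : f ∈ B <;> simp [he, hf]

lemma bexp_linSum_piecewise (p : ℝ) {U S : Finset V} (hUS : U ⊆ S) (ω : Sym2 V → Bool) :
    bexp p (fun η => linSum p S ((edgesIn U).piecewise ω η)) = linSum p U ω := by
  simp only [linSum, bexp_sum, bexp_centred_piecewise]
  rw [← Finset.sum_filter, Finset.filter_mem_eq_inter,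
    Finset.inter_eq_right.2 (edgesIn_mono hUS)]

lemma bexp_disjSum_piecewise (p : ℝ) {U S : Finset V} (hUS : U ⊆ S) (ω : Sym2 V → Bool) :
    bexp p (fun η => disjSum p S ((edgesIn U).piecewise ω η)) = disjSum p U ω := by
  simp only [disjSum, bexp_sum]
  rw [Finset.sum_congr rfl fun q hq => bexp_centred_mul_piecewise p (edgesIn U) ω
    (ne_of_disjoint_toFinset (mem_disjPairs.1 hq).2), ← Finset.sum_filter]
  refine Finset.sum_congr ?_ fun _ _ => rfl
  ext q
  simp only [Finset.mem_filter, mem_disjPairs]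
  have := @edgesIn_mono V _ _ _ hUS
  constructor
  · rintro ⟨⟨_, h⟩, h'⟩; exact ⟨h', h⟩
  · rintro ⟨h', h⟩; exact ⟨⟨⟨this h'.1, this h'.2⟩, h⟩, h'⟩

lemma bexp_linSum (p : ℝ) (S : Finset V) : bexp p (linSum p S) = 0 := by
  have : linSum p S = fun ω => ∑ e ∈ edgesIn S, centred p ω e := rfl
  rw [this, bexp_sum]
  exact Finset.sum_eq_zero fun e _ => bexp_centred p e

/-- The two edges of a disjoint pair differ, so at least one of them is not `e` and appears as an
isolated centred factor. -/
lemma bexp_disjSum_mul_centred (p : ℝ) (S : Finset V) (e : Sym2 V) :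
    bexp p (fun ω => disjSum p S ω * centred p ω e) = 0 := by
  simp only [disjSum, Finset.sum_mul]
  rw [bexp_sum]
  refine Finset.sum_eq_zero fun q hq => ?_
  have hne := ne_of_disjoint_toFinset (mem_disjPairs.1 hq).2
  by_cases h : q.1 = e
  · have : (fun ω : Sym2 V → Bool => centred p ω q.1 * centred p ω q.2 * centred p ω e) =
        fun ω => centred p ω q.2 * (centred p ω q.1 * centred p ω e) := by ext; ring
    rw [this]
    refine bexp_centred_mul p (B := {q.1} ∪ {e}) ?_
      ((dependsOn_centred p _).mul (dependsOn_centred p _))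
    simp [← h, hne.symm]
  · simp only [mul_assoc]
    refine bexp_centred_mul p (B := {q.2} ∪ {e}) ?_
      ((dependsOn_centred p _).mul (dependsOn_centred p _))
    simp [h, hne]

lemma bexp_disjSum (p : ℝ) (S : Finset V) : bexp p (disjSum p S) = 0 := by
  have : disjSum p S = fun ω => ∑ q ∈ disjPairs S, centred p ω q.1 * centred p ω q.2 := rfl
  rw [this, bexp_sum]
  refine Finset.sum_eq_zero fun q hq => bexp_centred_mul p (B := {q.2}) ?_ (dependsOn_centred p _)
  simpa using ne_of_disjoint_toFinset (mem_disjPairs.1 hq).2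

lemma bexp_adjSum (p : ℝ) (S : Finset V) : bexp p (adjSum p S) = 0 := by
  have : adjSum p S = fun ω => ∑ q ∈ adjPairs S, centred p ω q.1 * centred p ω q.2 := rfl
  rw [this, bexp_sum]
  refine Finset.sum_eq_zero fun q hq => bexp_centred_mul p (B := {q.2}) ?_ (dependsOn_centred p _)
  simpa using (mem_adjPairs.1 hq).2.1

lemma bexp_linSum_sq (p : ℝ) (S : Finset V) :
    bexp p (fun ω => linSum p S ω ^ 2) = (edgesIn S).card * (p * (1 - p)) := by
  simp only [linSum_sq, bexp_add, bexp_const_mul, bexp_const]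
  rw [bexp_linSum, bexp_disjSum, bexp_adjSum]
  ring

/-- A common vertex and the two other endpoints determine the pair: three vertices, against four for
a disjoint pair. -/
lemma card_adjPairs_le {V : Type*} [DecidableEq V] (S : Finset V) :
    (adjPairs S).card ≤ S.card ^ 3 := by
  have : adjPairs S ⊆ (S ×ˢ S ×ˢ S).image (fun t => (s(t.1, t.2.1), s(t.1, t.2.2))) := by
    rintro ⟨e, f⟩ h
    rw [mem_adjPairs, mem_edgesIn, mem_edgesIn, Finset.not_disjoint_iff] at h
    obtain ⟨⟨⟨he, -⟩, hf, -⟩, -, a, ha, ha'⟩ := h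
    simp only [Sym2.mem_toFinset] at ha ha'
    obtain ⟨b, rfl⟩ := Sym2.mem_iff_exists.1 ha
    obtain ⟨c, rfl⟩ := Sym2.mem_iff_exists.1 ha'
    simp only [Sym2.toFinset_mk_eq, Finset.insert_subset_iff, Finset.singleton_subset_iff] at he hf
    exact Finset.mem_image.2 ⟨(a, b, c), by simp [he, hf], rfl⟩
  calc _ ≤ _ := Finset.card_le_card this
    _ ≤ _ := Finset.card_image_le
    _ = _ := by rw [Finset.card_product, Finset.card_product]; ring

/-- Unless `r` is `q` or its swap, some edge of `q` occurs exactly once in the product. -/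
lemma bexp_mul_pair_eq_zero (p : ℝ) {q r : Sym2 V × Sym2 V} (hq : q.1 ≠ q.2)
    (h1 : q.1 ≠ r.1 ∨ q.2 ≠ r.2) (h2 : q.1 ≠ r.2 ∨ q.2 ≠ r.1) :
    bexp p (fun ω => (centred p ω q.1 * centred p ω q.2) *
      (centred p ω r.1 * centred p ω r.2)) = 0 := by
  by_cases h : q.1 ≠ r.1 ∧ q.1 ≠ r.2
  · simp only [mul_assoc]
    refine bexp_centred_mul p (B := {q.2} ∪ ({r.1} ∪ {r.2})) (by simp [hq, h])
      ((dependsOn_centred p _).mul ((dependsOn_centred p _).mul (dependsOn_centred p _)))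
  · have h' : q.2 ≠ r.1 ∧ q.2 ≠ r.2 := by
      rw [not_and_or, not_not, not_not] at h
      rcases h with h | h
      · refine ⟨fun h3 => hq (h.trans h3.symm), ?_⟩
        rcases h1 with h1 | h1
        · exact absurd h h1
        · exact h1
      · refine ⟨?_, fun h3 => hq (h.trans h3.symm)⟩
        rcases h2 with h2 | h2
        · exact absurd h h2
        · exact h2
    have e : (fun ω : Sym2 V → Bool => (centred p ω q.1 * centred p ω q.2) *
        (centred p ω r.1 * centred p ω r.2)) = fun ω => centred p ω q.2 *
        (centred p ω q.1 * (centred p ω r.1 * centred p ω r.2)) := by ext; ring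
    rw [e]
    refine bexp_centred_mul p (B := {q.1} ∪ ({r.1} ∪ {r.2})) (by simp [hq.symm, h'])
      ((dependsOn_centred p _).mul ((dependsOn_centred p _).mul (dependsOn_centred p _)))

lemma bexp_adjSum_sq_le {p : ℝ} (h0 : 0 ≤ p) (h1 : p ≤ 1) (S : Finset V) :
    bexp p (fun ω => adjSum p S ω ^ 2) ≤ 2 * (S.card : ℝ) ^ 3 := by
  have e : (fun ω => adjSum p S ω ^ 2) = fun ω => ∑ q ∈ adjPairs S, ∑ r ∈ adjPairs S,
      (centred p ω q.1 * centred p ω q.2) * (centred p ω r.1 * centred p ω r.2) := by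
    ext ω
    rw [sq, adjSum, Finset.sum_mul_sum]
  rw [e, bexp_sum]
  simp only [bexp_sum]
  have hle : ∀ q ∈ adjPairs S, ∀ r ∈ adjPairs S,
      bexp p (fun ω => (centred p ω q.1 * centred p ω q.2) *
        (centred p ω r.1 * centred p ω r.2)) ≤
      (if r = q then 1 else 0) + (if r = q.swap then 1 else 0) := by
    intro q hq r hr
    by_cases hc : r = q ∨ r = q.swap
    · have : bexp p (fun ω => (centred p ω q.1 * centred p ω q.2) *
          (centred p ω r.1 * centred p ω r.2)) ≤ 1 := by
        rw [← bexp_const (ι := Sym2 V) p 1]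
        refine bexp_mono h0 h1 fun ω => (le_abs_self _).trans ?_
        simp only [abs_mul]
        have a := fun e => abs_centred_le h0 h1 ω e
        exact mul_le_one₀ (mul_le_one₀ (a _) (abs_nonneg _) (a _)) (by positivity)
          (mul_le_one₀ (a _) (abs_nonneg _) (a _))
      refine this.trans ?_
      rcases hc with hc | hc
      · rw [if_pos hc]; split_ifs <;> norm_num
      · rw [if_pos hc]; split_ifs <;> norm_num
    · push Not at hc
      rw [bexp_mul_pair_eq_zero p (mem_adjPairs.1 hq).2.1 _ _,
        if_neg hc.1, if_neg hc.2, add_zero]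
      · by_contra! h
        exact hc.1 (Prod.ext h.1.symm h.2.symm)
      · by_contra! h
        exact hc.2 (Prod.ext h.2.symm h.1.symm)
  calc _ ≤ ∑ q ∈ adjPairs S, ∑ r ∈ adjPairs S,
        (((if r = q then 1 else 0) + (if r = q.swap then 1 else 0) : ℝ)) :=
        Finset.sum_le_sum fun q hq => Finset.sum_le_sum fun r hr => hle q hq r hr
    _ ≤ ∑ q ∈ adjPairs S, (2 : ℝ) := by
        refine Finset.sum_le_sum fun q hq => ?_
        rw [Finset.sum_add_distrib, Finset.sum_ite_eq', Finset.sum_ite_eq']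
        split_ifs <;> norm_num
    _ = 2 * ((adjPairs S).card : ℝ) := by simp [mul_comm]
    _ ≤ _ := by
        gcongr
        exact_mod_cast card_adjPairs_le S

end EdgeSums

/-! ### Expansion of sums of local statistics and orthogonality of residuals. -/

section LocalStatistics

variable {V : Type*} [Fintype V] [DecidableEq V]

lemma card_powersetCard_univ_filter_subset {k : ℕ} (U : Finset V) (hU : U.card ≤ k) :
    ((Finset.univ.powersetCard k).filter (U ⊆ ·)).card =
      (Fintype.card V - U.card).choose (k - U.card) := by
  rw [Finset.card_filter_powersetCard_subset _ _ _ (Finset.subset_univ _) hU, Finset.card_univ]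

lemma sum_linSum (p : ℝ) {k : ℕ} (hk : 2 ≤ k) (ω : Sym2 V → Bool) :
    ∑ S ∈ Finset.univ.powersetCard k, linSum p S ω =
      ((Fintype.card V - 2).choose (k - 2) : ℝ) * linSum p Finset.univ ω := by
  simp only [linSum]
  rw [Finset.sum_comm' (t' := edgesIn Finset.univ)
    (s' := fun e => (Finset.univ.powersetCard k).filter (e.toFinset ⊆ ·)), Finset.mul_sum]
  · refine Finset.sum_congr rfl fun e he => ?_
    have h2 := Sym2.card_toFinset_of_not_isDiag e (mem_edgesIn.1 he).2
    rw [Finset.sum_const, card_powersetCard_univ_filter_subset _ (by omega), h2, nsmul_eq_mul]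
  · intro S e
    simp only [Finset.mem_filter, mem_edgesIn, Finset.subset_univ, true_and]
    tauto

/-- Double counting: a disjoint pair spans four vertices, which lie in `(n - 4).choose (k - 4)` of
the `k`-sets, where `n` is the number of vertices. -/
lemma sum_powersetCard_sum_disjPairs {k : ℕ} (hk : 4 ≤ k) (F : Sym2 V × Sym2 V → ℝ) :
    ∑ S ∈ Finset.univ.powersetCard k, ∑ q ∈ disjPairs S, F q =
      ((Fintype.card V - 4).choose (k - 4) : ℝ) * ∑ q ∈ disjPairs Finset.univ, F q := by
  rw [Finset.sum_comm' (t' := disjPairs Finset.univ)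
    (s' := fun q => (Finset.univ.powersetCard k).filter (q.1.toFinset ∪ q.2.toFinset ⊆ ·)),
    Finset.mul_sum]
  · refine Finset.sum_congr rfl fun q hq => ?_
    rw [mem_disjPairs, mem_edgesIn, mem_edgesIn] at hq
    have h1 := Sym2.card_toFinset_of_not_isDiag q.1 hq.1.1.2
    have h2 := Sym2.card_toFinset_of_not_isDiag q.2 hq.1.2.2
    have h4 : (q.1.toFinset ∪ q.2.toFinset).card = 4 := by
      rw [Finset.card_union_of_disjoint hq.2, h1, h2]
    rw [Finset.sum_const, card_powersetCard_univ_filter_subset _ (by omega), h4, nsmul_eq_mul]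
  · intro S q
    simp only [Finset.mem_filter, mem_disjPairs, mem_edgesIn, Finset.subset_univ, true_and,
      Finset.union_subset_iff]
    tauto

lemma sum_disjSum (p : ℝ) {k : ℕ} (hk : 4 ≤ k) (ω : Sym2 V → Bool) :
    ∑ S ∈ Finset.univ.powersetCard k, disjSum p S ω =
      ((Fintype.card V - 4).choose (k - 4) : ℝ) * disjSum p Finset.univ ω :=
  sum_powersetCard_sum_disjPairs hk fun q => centred p ω q.1 * centred p ω q.2

/-- Choose five common vertices, then complete each set by `k - 5` more. For `k = 4` there are no
such pairs, and the case is separate because `k - 5` truncates. -/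
lemma card_pairs_inter_le {k : ℕ} (hk : 4 ≤ k) :
    (((Finset.univ : Finset V).powersetCard k ×ˢ Finset.univ.powersetCard k).filter
      fun z => 5 ≤ (z.1 ∩ z.2).card).card ≤ Fintype.card V ^ (2 * k - 5) := by
  rcases hk.eq_or_lt with rfl | hk
  · rw [Finset.filter_eq_empty_iff.2]
    · simp
    · rintro ⟨S, T⟩ h
      simp only [Finset.mem_product, Finset.mem_powersetCard] at h
      have := Finset.card_le_card (Finset.inter_subset_left (s₁ := S) (s₂ := T))
      simp only
      omega
  set A : Finset V → Finset (Finset V) := fun T =>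
    (Finset.univ.powersetCard k).filter (T ⊆ ·)
  have hsub : (((Finset.univ : Finset V).powersetCard k ×ˢ Finset.univ.powersetCard k).filter
      fun z => 5 ≤ (z.1 ∩ z.2).card) ⊆
      (Finset.univ.powersetCard 5).biUnion fun T => A T ×ˢ A T := by
    rintro ⟨S, S'⟩ h
    simp only [Finset.mem_filter, Finset.mem_product] at h
    obtain ⟨T, hT, hT5⟩ := Finset.exists_subset_card_eq h.2
    rw [Finset.subset_inter_iff] at hT
    simp only [Finset.mem_biUnion, Finset.mem_powersetCard, Finset.subset_univ, true_and,
      Finset.mem_product, A, Finset.mem_filter] at h ⊢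
    exact ⟨T, hT5, ⟨h.1.1, hT.1⟩, h.1.2, hT.2⟩
  have hA : ∀ T ∈ (Finset.univ : Finset V).powersetCard 5,
      (A T ×ˢ A T).card ≤ Fintype.card V ^ (2 * (k - 5)) := fun T hT => by
    have hT5 := (Finset.mem_powersetCard.1 hT).2
    have : (A T).card ≤ Fintype.card V ^ (k - 5) := by
      rw [card_powersetCard_univ_filter_subset T (by omega), hT5]
      exact (Nat.choose_le_pow _ _).trans (Nat.pow_le_pow_left (Nat.sub_le _ _) _)
    calc _ = (A T).card * (A T).card := Finset.card_product _ _
      _ ≤ _ := Nat.mul_le_mul this this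
      _ = _ := by rw [← pow_add, two_mul]
  calc _ ≤ _ := Finset.card_le_card hsub
    _ ≤ _ := Finset.card_biUnion_le_card_mul _ _ _ hA
    _ ≤ Fintype.card V ^ 5 * Fintype.card V ^ (2 * (k - 5)) := by
        refine Nat.mul_le_mul_right _ ?_
        rw [Finset.card_powersetCard, Finset.card_univ]
        exact Nat.choose_le_pow _ _
    _ = _ := by rw [← pow_add]; congr 1; omega

/-- A statistic of the graphs induced on `k`-sets whose conditional expectation given the edges
inside a `4`-set is a combination of a constant, the centred number of edges and the centred number
of pairs of disjoint edges. -/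
structure IsLocalStat (p : ℝ) (k : ℕ) (a b c K : ℝ)
    (g : Finset V → (Sym2 V → Bool) → ℝ) : Prop where
  dependsOn : ∀ S, S.card = k → DependsOnCoords (edgesIn S) (g S)
  abs_le : ∀ S, S.card = k → ∀ ω, |g S ω| ≤ K
  average : ∀ S, S.card = k → ∀ U ⊆ S, U.card = 4 → ∀ ω,
    bexp p (fun η => g S ((edgesIn U).piecewise ω η)) = a + b * linSum p U ω + c * disjSum p U ω

/-- The part of a local statistic that is not explained by its expansion of low order. -/
def localResidual {V : Type*} [DecidableEq V] (p a b c : ℝ) (g : Finset V → (Sym2 V → Bool) → ℝ)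
    (S : Finset V) (ω : Sym2 V → Bool) : ℝ :=
  g S ω - (a + b * linSum p S ω + c * disjSum p S ω)

namespace IsLocalStat

variable {p : ℝ} {k : ℕ} {a b c K : ℝ} {g : Finset V → (Sym2 V → Bool) → ℝ}

lemma abs_residual_le (hg : IsLocalStat p k a b c K g) (h0 : 0 ≤ p) (h1 : p ≤ 1) {S : Finset V}
    (hS : S.card = k) (ω : Sym2 V → Bool) :
    |localResidual p a b c g S ω| ≤ K + (|a| + |b| * k ^ 2 + |c| * k ^ 4) := by
  have e1 := abs_linSum_le h0 h1 S ω
  have e2 := abs_disjSum_le h0 h1 S ω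
  rw [hS] at e1 e2
  refine (abs_sub _ _).trans (add_le_add (hg.abs_le S hS ω) ?_)
  refine (abs_add_three _ _ _).trans ?_
  rw [abs_mul, abs_mul]
  gcongr

/-- The sums over `S` project to those over `U`, so `average` says precisely that the residual has
zero conditional mean given the edges in a `4`-set. -/
lemma bexp_residual_piecewise (hg : IsLocalStat p k a b c K g) {S U : Finset V}
    (hS : S.card = k) (hUS : U ⊆ S) (hU : U.card = 4) (ω : Sym2 V → Bool) :
    bexp p (fun η => localResidual p a b c g S ((edgesIn U).piecewise ω η)) = 0 := by
  simp only [localResidual, bexp_sub, bexp_add, bexp_const, bexp_const_mul,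
    bexp_linSum_piecewise p hUS, bexp_disjSum_piecewise p hUS]
  rw [hg.average S hS U hUS hU, sub_self]

lemma dependsOn_residual (hg : IsLocalStat p k a b c K g) {S : Finset V} (hS : S.card = k) :
    DependsOnCoords (edgesIn S) (localResidual p a b c g S) := fun ω ω' h => by
  simp only [localResidual, hg.dependsOn S hS ω ω' h, dependsOn_linSum p S ω ω' h,
    dependsOn_disjSum p S ω ω' h]

/-- Enlarge `S ∩ T` to a `4`-set `U ⊆ S` and condition on the edges in `T` and in `U`. An edge
inside both `S` and `T` lies in `U`, so the residual of `S` only sees the edges of `U` fixed, and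
its conditional mean vanishes. -/
lemma bexp_residual_mul_eq_zero (hg : IsLocalStat p k a b c K g) (hk : 4 ≤ k) {S T : Finset V}
    (hS : S.card = k) (hST : (S ∩ T).card ≤ 4) {f : (Sym2 V → Bool) → ℝ}
    (hf : DependsOnCoords (edgesIn T) f) :
    bexp p (fun ω => localResidual p a b c g S ω * f ω) = 0 := by
  obtain ⟨U, hU1, hU2, hU4⟩ := Finset.exists_subsuperset_card_eq
    (Finset.inter_subset_left (s₁ := S) (s₂ := T)) hST (by omega : 4 ≤ S.card)
  refine bexp_mul_eq_zero (hf.mono (Finset.subset_union_left (s₂ := edgesIn U))) fun ω => ?_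
  rw [← hg.bexp_residual_piecewise hS hU2 hU4 ω]
  congr 1
  ext η
  refine hg.dependsOn_residual hS _ _ fun e he => ?_
  have : e ∈ edgesIn T ∪ edgesIn U ↔ e ∈ edgesIn U := by
    rw [Finset.mem_union, or_iff_right_iff_imp]
    intro h
    rw [mem_edgesIn] at h he ⊢
    exact ⟨(Finset.subset_inter he.1 h.1).trans hU1, he.2⟩
  by_cases h : e ∈ edgesIn U
  · rw [Finset.piecewise_eq_of_mem _ _ _ (this.2 h), Finset.piecewise_eq_of_mem _ _ _ h]
  · rw [Finset.piecewise_eq_of_notMem _ _ _ (mt this.1 h), Finset.piecewise_eq_of_notMem _ _ _ h]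

lemma bexp_sum_residual_sq_le (hg : IsLocalStat p k a b c K g) (h0 : 0 ≤ p) (h1 : p ≤ 1)
    (hk : 4 ≤ k) :
    bexp p (fun ω => (∑ S ∈ Finset.univ.powersetCard k, localResidual p a b c g S ω) ^ 2) ≤
      (K + (|a| + |b| * k ^ 2 + |c| * k ^ 4)) ^ 2 * (Fintype.card V : ℝ) ^ (2 * k - 5) := by
  set L := K + (|a| + |b| * k ^ 2 + |c| * k ^ 4)
  set P := (Finset.univ : Finset V).powersetCard k
  have e : (fun ω => (∑ S ∈ P, localResidual p a b c g S ω) ^ 2) = fun ω =>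
      ∑ z ∈ P ×ˢ P, localResidual p a b c g z.1 ω * localResidual p a b c g z.2 ω := by
    ext ω
    rw [sq, Finset.sum_mul_sum, ← Finset.sum_product']
  have hle : ∀ z ∈ P ×ˢ P,
      bexp p (fun ω => localResidual p a b c g z.1 ω * localResidual p a b c g z.2 ω) ≤
      if 5 ≤ (z.1 ∩ z.2).card then L ^ 2 else 0 := by
    rintro ⟨S, T⟩ hz
    simp only [P, Finset.mem_product, Finset.mem_powersetCard, Finset.subset_univ, true_and] at hz
    split_ifs with h
    · rw [← bexp_const (ι := Sym2 V) p (L ^ 2)]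
      refine bexp_mono h0 h1 fun ω => (le_abs_self _).trans ?_
      rw [abs_mul, sq]
      have hS := hg.abs_residual_le h0 h1 hz.1 ω
      exact mul_le_mul hS (hg.abs_residual_le h0 h1 hz.2 ω) (abs_nonneg _)
        ((abs_nonneg _).trans hS)
    · exact (hg.bexp_residual_mul_eq_zero hk hz.1 (by simp only at h; omega)
        (hg.dependsOn_residual hz.2)).le
  rw [e, bexp_sum]
  refine (Finset.sum_le_sum hle).trans ?_
  rw [← Finset.sum_filter, Finset.sum_const, nsmul_eq_mul, mul_comm]
  gcongr
  exact_mod_cast card_pairs_inter_le hk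

lemma bexp_sum_residual_mul_linSum (hg : IsLocalStat p k a b c K g) (hk : 4 ≤ k) :
    bexp p (fun ω => (∑ S ∈ Finset.univ.powersetCard k, localResidual p a b c g S ω) *
      linSum p Finset.univ ω) = 0 := by
  simp only [linSum, Finset.sum_mul_sum]
  rw [bexp_sum]
  refine Finset.sum_eq_zero fun S hS => ?_
  rw [bexp_sum]
  refine Finset.sum_eq_zero fun e he => ?_
  refine hg.bexp_residual_mul_eq_zero hk (Finset.mem_powersetCard.1 hS).2 (T := e.toFinset) ?_
    ((dependsOn_centred p e).mono ?_)
  · refine (Finset.card_le_card Finset.inter_subset_right).trans ?_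
    rw [Sym2.card_toFinset]
    split_ifs <;> norm_num
  · rw [Finset.singleton_subset_iff, mem_edgesIn]
    exact ⟨subset_rfl, (mem_edgesIn.1 he).2⟩

/-- The expansion of the sum of a local statistic over all `k`-sets. -/
lemma sum_eq (p a b c : ℝ) (g : Finset V → (Sym2 V → Bool) → ℝ) {k : ℕ} (hk : 4 ≤ k)
    (ω : Sym2 V → Bool) :
    ∑ S ∈ Finset.univ.powersetCard k, g S ω =
      ((Fintype.card V).choose k : ℝ) * a +
      b * ((Fintype.card V - 2).choose (k - 2) : ℝ) * linSum p Finset.univ ω +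
      c * ((Fintype.card V - 4).choose (k - 4) : ℝ) * disjSum p Finset.univ ω +
      ∑ S ∈ Finset.univ.powersetCard k, localResidual p a b c g S ω := by
  simp only [localResidual, Finset.sum_sub_distrib, Finset.sum_add_distrib, ← Finset.mul_sum,
    sum_linSum p (by omega : 2 ≤ k), sum_disjSum p hk]
  rw [Finset.sum_const, Finset.card_powersetCard, Finset.card_univ, nsmul_eq_mul]
  ring

lemma bexp_sum_mul_linSum (hg : IsLocalStat p k a b c K g) (hk : 4 ≤ k) :
    bexp p (fun ω => (∑ S ∈ Finset.univ.powersetCard k, g S ω) * linSum p Finset.univ ω) =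
      b * ((Fintype.card V - 2).choose (k - 2) : ℝ) *
        ((edgesIn (Finset.univ : Finset V)).card * (p * (1 - p))) := by
  have hd : bexp p (fun ω =>
      disjSum p (Finset.univ : Finset V) ω * linSum p Finset.univ ω) = 0 := by
    conv_lhs => enter [2, ω]; rw [linSum, Finset.mul_sum]
    rw [bexp_sum]
    exact Finset.sum_eq_zero fun e _ => bexp_disjSum_mul_centred p _ e
  have hl : bexp p (fun ω => linSum p (Finset.univ : Finset V) ω * linSum p Finset.univ ω) =
      (edgesIn (Finset.univ : Finset V)).card * (p * (1 - p)) := by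
    rw [← bexp_linSum_sq]; simp only [sq]
  simp only [sum_eq p a b c g hk, add_mul, bexp_add, mul_assoc, bexp_const_mul, hd, hl,
    hg.bexp_sum_residual_mul_linSum hk]
  rw [bexp_linSum]
  ring

/-- Only the linear term correlates with `linSum`; the bound is Cauchy–Schwarz against it, with one
factor of the variance of `linSum` cancelled. -/
lemma le_bvar (hg : IsLocalStat p k a b c K g) (h0 : 0 < p) (h1 : p < 1) (hk : 4 ≤ k)
    (hV : k ≤ Fintype.card V) :
    (b * ((Fintype.card V - 2).choose (k - 2) : ℝ)) ^ 2 *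
        ((edgesIn (Finset.univ : Finset V)).card * (p * (1 - p))) ≤
      bvar p (fun ω => ∑ S ∈ Finset.univ.powersetCard k, g S ω) := by
  have h := bexp_mul_sq_le_bvar_mul h0.le h1.le
    (fun ω => ∑ S ∈ Finset.univ.powersetCard k, g S ω) (linSum p Finset.univ) (bexp_linSum p _)
  rw [hg.bexp_sum_mul_linSum hk, bexp_linSum_sq] at h
  have hE : 0 < (edgesIn (Finset.univ : Finset V)).card :=
    card_edgesIn_pos (by rw [Finset.card_univ]; omega)
  have hpos : 0 < ((edgesIn (Finset.univ : Finset V)).card : ℝ) * (p * (1 - p)) := by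
    have : 0 < 1 - p := by linarith
    positivity
  refine le_of_mul_le_mul_right ?_ hpos
  calc _ = _ := by ring
    _ ≤ _ := h

end IsLocalStat

end LocalStatistics

/-! ### Variance and point probabilities of sums of local statistics. -/

section LocalStatisticsPointProbability

lemma card_edgesIn {V : Type*} [DecidableEq V] (S : Finset V) :
    (edgesIn S).card = S.card.choose 2 := by
  rw [← Sym2.card_image_offDiag]
  congr 1
  ext e
  induction e using Sym2.ind with
  | _ a b =>
    simp only [mem_edgesIn, Sym2.toFinset_mk_eq, Finset.insert_subset_iff,
      Finset.singleton_subset_iff, Sym2.mk_isDiag_iff, Finset.mem_image, Finset.mem_offDiag]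
    constructor
    · rintro ⟨⟨ha, hb⟩, hab⟩
      exact ⟨(a, b), ⟨ha, hb, hab⟩, rfl⟩
    · rintro ⟨⟨x, y⟩, ⟨hx, hy, hxy⟩, h⟩
      rcases Sym2.eq_iff.1 h with ⟨rfl, rfl⟩ | ⟨rfl, rfl⟩
      · exact ⟨⟨hx, hy⟩, hxy⟩
      · exact ⟨⟨hy, hx⟩, hxy.symm⟩

lemma sq_div_four_le_choose_two {n : ℕ} (hn : 2 ≤ n) : (n : ℝ) ^ 2 / 4 ≤ n.choose 2 := by
  rw [Nat.cast_choose_two]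
  have : (2 : ℝ) ≤ n := by exact_mod_cast hn
  nlinarith

/-- Each factor of the falling product is at least `n - k + 1`, which is at least `n / k` as soon as
`k ≤ n`; hence the bounds need no largeness of `n`. -/
lemma div_pow_le_choose {n k : ℕ} (hk : 2 ≤ k) (hn : k ≤ n) :
    (n : ℝ) ^ (k - 2) / ((k : ℝ) ^ (k - 2) * (k - 2).factorial) ≤ (n - 2).choose (k - 2) := by
  refine le_trans ?_ (Nat.pow_le_choose (α := ℝ) (k - 2) (n - 2))
  rw [← div_div, ← div_pow]
  gcongr
  have hk0 : (0 : ℝ) < k := by exact_mod_cast (by omega : 0 < k)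
  rw [div_le_iff₀ hk0]
  have : n ≤ (n - 2 + 1 - (k - 2)) * k := by
    obtain ⟨d, rfl⟩ := Nat.exists_eq_add_of_le hn
    have : k + d - 2 + 1 - (k - 2) = d + 1 := by omega
    rw [this]
    nlinarith
  exact_mod_cast this

/-- The number of coordinates of `ω` that are edges. -/
def edgeNum {V : Type*} [Fintype V] [DecidableEq V] (ω : Sym2 V → Bool) : ℕ :=
  ((edgesIn (Finset.univ : Finset V)).filter fun e => ω e = true).card

lemma linSum_univ {V : Type*} [Fintype V] [DecidableEq V] (p : ℝ) (ω : Sym2 V → Bool) :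
    linSum p Finset.univ ω = edgeNum ω - (edgesIn (Finset.univ : Finset V)).card * p := by
  simp only [linSum, centred, Finset.sum_sub_distrib, Finset.sum_const, nsmul_eq_mul, edgeNum,
    Finset.card_filter, Nat.cast_sum]
  congr 1
  refine Finset.sum_congr rfl fun e _ => ?_
  cases ω e <;> simp

variable {V : Type*} [Fintype V] [DecidableEq V] {p : ℝ} {k : ℕ} {a b c K : ℝ}
  {g : Finset V → (Sym2 V → Bool) → ℝ}

lemma IsLocalStat.bvar_ge (hg : IsLocalStat p k a b c K g) (h0 : 0 < p) (h1 : p < 1) (hk : 4 ≤ k)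
    (hV : k ≤ Fintype.card V) :
    (b / ((k : ℝ) ^ (k - 2) * (k - 2).factorial)) ^ 2 * (p * (1 - p) / 4) *
        ((Fintype.card V : ℝ) ^ (k - 1)) ^ 2 ≤
      bvar p (fun ω => ∑ S ∈ Finset.univ.powersetCard k, g S ω) := by
  refine le_trans ?_ (hg.le_bvar h0 h1 hk hV)
  have e1 := div_pow_le_choose (by omega : 2 ≤ k) hV
  have e2 := sq_div_four_le_choose_two (by omega : 2 ≤ Fintype.card V)
  rw [card_edgesIn, Finset.card_univ]
  have hp : 0 ≤ p * (1 - p) := mul_nonneg h0.le (by linarith)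
  have e3 : (Fintype.card V : ℝ) ^ (k - 1) =
      (Fintype.card V : ℝ) ^ (k - 2) * Fintype.card V := by
    rw [← pow_succ]; congr 1; omega
  set n : ℝ := (Fintype.card V : ℝ)
  set d : ℝ := (k : ℝ) ^ (k - 2) * (k - 2).factorial
  calc (b / d) ^ 2 * (p * (1 - p) / 4) * (n ^ (k - 1)) ^ 2
      = b ^ 2 * (n ^ (k - 2) / d) ^ 2 * ((n ^ 2 / 4) * (p * (1 - p))) := by rw [e3]; ring
    _ ≤ b ^ 2 * ((Fintype.card V - 2).choose (k - 2) : ℝ) ^ 2 *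
        (((Fintype.card V).choose 2 : ℝ) * (p * (1 - p))) := by gcongr
    _ = _ := by ring

/-- The conditional expectation of the sum of a local statistic given the number `j` of edges, up
to terms of lower order. -/
def edgeNumPrediction (p a b c : ℝ) (n k : ℕ) (j : ℕ) : ℝ :=
  (n.choose k : ℝ) * a + b * ((n - 2).choose (k - 2) : ℝ) * (j - n.choose 2 * p) +
    c * ((n - 4).choose (k - 4) : ℝ) * ((j - n.choose 2 * p) ^ 2 -
      ((1 - 2 * p) * (j - n.choose 2 * p) + n.choose 2 * (p * (1 - p))))

lemma IsLocalStat.sum_sub_prediction (p a b c : ℝ) (g : Finset V → (Sym2 V → Bool) → ℝ) {k : ℕ}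
    (hk : 4 ≤ k) (ω : Sym2 V → Bool) :
    ∑ S ∈ Finset.univ.powersetCard k, g S ω -
        edgeNumPrediction p a b c (Fintype.card V) k (edgeNum ω) =
      ∑ S ∈ Finset.univ.powersetCard k, localResidual p a b c g S ω -
        c * ((Fintype.card V - 4).choose (k - 4) : ℝ) * adjSum p Finset.univ ω := by
  have h1 := linSum_univ p ω
  have h2 := linSum_sq p Finset.univ ω
  rw [card_edgesIn, Finset.card_univ] at h1 h2
  rw [IsLocalStat.sum_eq p a b c g hk, edgeNumPrediction, ← h1, h2]
  ring

/-- Two errors remain after `linSum_sq` eliminates `disjSum`: the residual, and `adjSum` with a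
coefficient of order `n ^ (k - 4)`. The latter contributes `n ^ (2 * (k - 4)) * n ^ 3`, the same
order `n ^ (2 * k - 5)` as the residual. -/
lemma IsLocalStat.bexp_sub_prediction_sq_le (hg : IsLocalStat p k a b c K g) (h0 : 0 ≤ p)
    (h1 : p ≤ 1) (hk : 4 ≤ k) :
    bexp p (fun ω => (∑ S ∈ Finset.univ.powersetCard k, g S ω -
        edgeNumPrediction p a b c (Fintype.card V) k (edgeNum ω)) ^ 2) ≤
      (2 * (K + (|a| + |b| * k ^ 2 + |c| * k ^ 4)) ^ 2 + 4 * c ^ 2) *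
        (Fintype.card V : ℝ) ^ (2 * k - 5) := by
  set L := K + (|a| + |b| * k ^ 2 + |c| * k ^ 4)
  have hC : ((Fintype.card V - 4).choose (k - 4) : ℝ) ≤ (Fintype.card V : ℝ) ^ (k - 4) := by
    exact_mod_cast (Nat.choose_le_pow _ _).trans
      (Nat.pow_le_pow_left (Nat.sub_le (Fintype.card V) 4) (k - 4))
  set C : ℝ := ((Fintype.card V - 4).choose (k - 4) : ℝ)
  set n : ℝ := (Fintype.card V : ℝ)
  have hadj : bexp p (fun ω => adjSum p (Finset.univ : Finset V) ω ^ 2) ≤ 2 * n ^ 3 := by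
    simpa using bexp_adjSum_sq_le h0 h1 (Finset.univ : Finset V)
  have hadj0 : 0 ≤ bexp p (fun ω => adjSum p (Finset.univ : Finset V) ω ^ 2) :=
    bexp_nonneg h0 h1 fun _ => sq_nonneg _
  calc _ ≤ bexp p (fun ω =>
        2 * (∑ S ∈ Finset.univ.powersetCard k, localResidual p a b c g S ω) ^ 2 +
          (2 * (c * C) ^ 2) * adjSum p (Finset.univ : Finset V) ω ^ 2) := by
        refine bexp_mono h0 h1 fun ω => ?_
        rw [IsLocalStat.sum_sub_prediction p a b c g hk]
        nlinarith [sq_nonneg (∑ S ∈ Finset.univ.powersetCard k, localResidual p a b c g S ω +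
          c * C * adjSum p (Finset.univ : Finset V) ω)]
    _ ≤ 2 * (L ^ 2 * n ^ (2 * k - 5)) + (2 * (c * n ^ (k - 4)) ^ 2) * (2 * n ^ 3) := by
        rw [bexp_add, bexp_const_mul, bexp_const_mul]
        refine add_le_add (mul_le_mul_of_nonneg_left (hg.bexp_sum_residual_sq_le h0 h1 hk)
          zero_le_two) (mul_le_mul ?_ hadj hadj0 (by positivity))
        rw [mul_pow, mul_pow]
        gcongr
    _ = _ := by
        have : n ^ (2 * k - 5) = (n ^ (k - 4)) ^ 2 * n ^ 3 := by
          rw [← pow_mul, ← pow_add]; congr 1; omega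
        rw [this]; ring

/-- An integer variable that is the sum over all `k`-sets of a local statistic with non-zero linear
part has positive variance and a value of probability at least of order
`√n / standard deviation`. -/
theorem IsLocalStat.exists_pointProb_ge (h0 : 0 < p) (h1 : p < 1) (hk : 4 ≤ k) (hb : b ≠ 0)
    (a c K : ℝ) :
    ∃ r : ℝ, 0 < r ∧ ∀ n : ℕ, k ≤ n → ∀ (g : Finset (Fin n) → (Sym2 (Fin n) → Bool) → ℝ)
      (X : (Sym2 (Fin n) → Bool) → ℤ), IsLocalStat p k a b c K g →
      (∀ ω, (X ω : ℝ) = ∑ S ∈ Finset.univ.powersetCard k, g S ω) →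
      0 < bvar p (fun ω => (X ω : ℝ)) ∧
      ∃ x : ℤ, r * (√(n : ℝ) / √(bvar p fun ω => (X ω : ℝ))) ≤
        bexp p (fun ω => if X ω = x then 1 else 0) := by
  set D := (b / ((k : ℝ) ^ (k - 2) * (k - 2).factorial)) ^ 2 * (p * (1 - p) / 4) with hD
  -- The summand `1` only serves to make the scale `A` below at least `1`.
  set L := 2 * (K + (|a| + |b| * k ^ 2 + |c| * k ^ 4)) ^ 2 + 4 * c ^ 2 + 1 with hL
  have hk0 : (0 : ℝ) < k := by exact_mod_cast (by omega : 0 < k)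
  have hp : 0 < p * (1 - p) := mul_pos h0 (by linarith)
  have hD0 : 0 < D := by positivity
  have hL1 : 1 ≤ L := by rw [hL]; nlinarith [sq_nonneg (K + (|a| + |b| * k ^ 2 + |c| * k ^ 4))]
  have hL0 : 0 < L := by linarith
  refine ⟨√D / (100 * √L), by positivity, fun n hn g X hg hX => ?_⟩
  have hX' : (fun ω => (X ω : ℝ)) = fun ω => ∑ S ∈ Finset.univ.powersetCard k, g S ω :=
    funext hX
  have hn1 : (1 : ℝ) ≤ n := by exact_mod_cast (by omega : 1 ≤ n)
  have hn0 : (0 : ℝ) < n := by linarith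
  have hvar := hg.bvar_ge h0 h1 hk (by simpa using hn)
  rw [← hX', Fintype.card_fin, ← hD] at hvar
  have hvar0 : 0 < bvar p (fun ω => (X ω : ℝ)) := lt_of_lt_of_le (by positivity) hvar
  refine ⟨hvar0, ?_⟩
  have hpred := hg.bexp_sub_prediction_sq_le h0.le h1.le hk
  simp only [← hX, Fintype.card_fin] at hpred
  set A := √(L * (n : ℝ) ^ (2 * k - 5)) with hA
  have hA2 : A ^ 2 = L * (n : ℝ) ^ (2 * k - 5) := Real.sq_sqrt (by positivity)
  have hA1 : 1 ≤ A := by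
    rw [hA, Real.one_le_sqrt]
    exact one_le_mul_of_one_le_of_one_le hL1 (one_le_pow₀ hn1)
  -- The scale of the edge number is `n`, since its variance is `n.choose 2 * (p * (1 - p)) ≤ n ^
  -- 2`.
  obtain ⟨x, hx⟩ := exists_bexp_eq_ge h0.le h1.le X edgeNum ((n.choose 2 : ℝ) * p)
    (edgeNumPrediction p a b c n k) hA1 hn1 (by
      have h := bexp_linSum_sq p (Finset.univ : Finset (Fin n))
      simp only [linSum_univ, card_edgesIn, Finset.card_univ, Fintype.card_fin] at h
      rw [h]
      have h2 : (n.choose 2 : ℝ) ≤ (n : ℝ) ^ 2 := by exact_mod_cast Nat.choose_le_pow n 2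
      have hp1 : p * (1 - p) ≤ 1 := by nlinarith
      calc _ ≤ (n : ℝ) ^ 2 * 1 := mul_le_mul h2 hp1 hp.le (by positivity)
        _ = _ := mul_one _) (by
      rw [hA2]
      refine hpred.trans ?_
      gcongr
      linarith)
  refine ⟨x, le_trans ?_ hx⟩
  have hs : √D * (n : ℝ) ^ (k - 1) ≤ √(bvar p fun ω => (X ω : ℝ)) := by
    refine Real.le_sqrt_of_sq_le ?_
    rw [mul_pow, Real.sq_sqrt hD0.le]
    exact hvar
  have hAn : A * √(n : ℝ) = √L * (n : ℝ) ^ (k - 2) := by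
    rw [hA, ← Real.sqrt_mul (by positivity), mul_assoc, ← pow_succ, Real.sqrt_mul hL0.le]
    congr 1
    rw [Real.sqrt_eq_iff_eq_sq (by positivity) (by positivity), ← pow_mul]
    congr 1
    omega
  have hsn : 0 < √(n : ℝ) := Real.sqrt_pos.2 hn0
  have hsD : 0 < √D := Real.sqrt_pos.2 hD0
  have hsL : 0 < √L := Real.sqrt_pos.2 hL0
  calc √D / (100 * √L) * (√(n : ℝ) / √(bvar p fun ω => (X ω : ℝ)))
      ≤ √D / (100 * √L) * (√(n : ℝ) / (√D * (n : ℝ) ^ (k - 1))) := by gcongr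
    _ = √(n : ℝ) / (100 * (√L * (n : ℝ) ^ (k - 2)) * n) := by
        have : (n : ℝ) ^ (k - 1) = (n : ℝ) ^ (k - 2) * n := by
          rw [← pow_succ]; congr 1; omega
        rw [this]
        field_simp
    _ = 1 / (100 * (A * n)) := by
        rw [← hAn]
        field_simp

end LocalStatisticsPointProbability

/-! ### From Bernoulli coordinates to the random graph. -/

section Transfer

/-- The graph whose edges are the non-diagonal coordinates with value `true`. -/
def graphOf {V : Type*} (ω : Sym2 V → Bool) : SimpleGraph V :=
  SimpleGraph.fromEdgeSet {e | ω e = true}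

lemma graphOf_adj {V : Type*} (ω : Sym2 V → Bool) (a b : V) :
    (graphOf ω).Adj a b ↔ ω s(a, b) = true ∧ a ≠ b := by
  simp [graphOf]

lemma graphOf_eq_iff {V : Type*} [Fintype V] [DecidableEq V] (ω : Sym2 V → Bool)
    (G : SimpleGraph V) [DecidablePred (· ∈ G.edgeSet)] :
    graphOf ω = G ↔
      ∀ e ∈ edgesIn (Finset.univ : Finset V), ω e = decide (e ∈ G.edgeSet) := by
  constructor
  · rintro rfl e he
    have := (mem_edgesIn.1 he).2
    rw [Bool.eq_iff_iff]
    simp [graphOf, this]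
  · intro h
    ext a b
    rw [graphOf_adj]
    by_cases hab : a = b
    · simp [hab]
    · rw [h s(a, b) (by simp [mem_edgesIn, hab])]
      simp [hab]

instance {V : Type*} [Countable V] : MeasurableSingletonClass (SimpleGraph V) where
  measurableSet_singleton G := by
    have : ({G} : Set (SimpleGraph V)) = SimpleGraph.edgeSet ⁻¹' {G.edgeSet} := by
      ext G'; simp
    rw [this]
    exact SimpleGraph.measurable_edgeSet (measurableSet_singleton _)

variable {V : Type*} [Fintype V] [DecidableEq V]

/-- The diagonal coordinates of `Sym2 V` do not affect `graphOf` and integrate out; the others each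
contribute `p` or `1 - p`. -/
lemma bexp_graphOf_eq (p : ℝ) (G : SimpleGraph V) [DecidablePred (graphOf · = G)] :
    bexp p (fun ω => if graphOf ω = G then 1 else 0) =
      p ^ G.edgeSet.ncard * (1 - p) ^ ((Nat.card V).choose 2 - G.edgeSet.ncard) := by
  classical
  have e : (fun ω : Sym2 V → Bool => if graphOf ω = G then (1 : ℝ) else 0) = fun ω =>
      ∏ e ∈ edgesIn (Finset.univ : Finset V),
        if ω (id e) = decide (e ∈ G.edgeSet) then 1 else 0 := by
    ext ω
    rw [Finset.prod_ite_zero]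
    simp [graphOf_eq_iff]
  rw [e, bexp_prod_comp p (edgesIn Finset.univ) id (Set.injOn_id _)
    (fun e b => if b = decide (e ∈ G.edgeSet) then 1 else 0)]
  have e2 : ∀ e ∈ edgesIn (Finset.univ : Finset V),
      (p * (if true = decide (e ∈ G.edgeSet) then 1 else 0) +
        (1 - p) * (if false = decide (e ∈ G.edgeSet) then 1 else 0)) =
      if e ∈ G.edgeSet then p else 1 - p := fun e _ => by
    by_cases h : e ∈ G.edgeSet <;> simp [h]
  have e3 : ((edgesIn (Finset.univ : Finset V)).filter (· ∈ G.edgeSet)).card =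
      G.edgeSet.ncard := by
    rw [← Set.ncard_coe_finset]
    congr 1
    ext e
    simp only [Finset.coe_filter, mem_edgesIn, Finset.subset_univ, true_and, Set.mem_ofPred_eq,
      and_iff_right_iff_imp]
    exact G.not_isDiag_of_mem_edgeSet
  rw [Finset.prod_congr rfl e2, Finset.prod_ite, Finset.prod_const, Finset.prod_const, e3]
  congr 2
  have := Finset.card_filter_add_card_filter_not (s := edgesIn (Finset.univ : Finset V))
    (· ∈ G.edgeSet)
  rw [card_edgesIn, Finset.card_univ, e3] at this
  rw [Nat.card_eq_fintype_card]
  omega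

lemma integral_binomialRandom (p : unitInterval) (f : SimpleGraph V → ℝ) :
    ∫ G, f G ∂(SimpleGraph.binomialRandom V p) = bexp p (fun ω => f (graphOf ω)) := by
  classical
  rw [integral_fintype (Integrable.of_finite)]
  have e : (fun ω : Sym2 V → Bool => f (graphOf ω)) = fun ω =>
      ∑ G, (if graphOf ω = G then 1 else 0) * f G := by
    ext ω; simp
  rw [e, bexp_sum]
  refine Finset.sum_congr rfl fun G _ => ?_
  rw [bexp_mul_const, bexp_graphOf_eq, smul_eq_mul, measureReal_def,
    SimpleGraph.binomialRandom_singleton]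
  simp

lemma stdDev_binomialRandom (p : unitInterval) (X : SimpleGraph V → ℝ) :
    stdDev (SimpleGraph.binomialRandom V p) X = √(bvar p fun ω => X (graphOf ω)) := by
  rw [stdDev, variance_eq_integral (Measurable.of_discrete).aemeasurable,
    integral_binomialRandom p X, integral_binomialRandom, bvar]

lemma bexp_le_maxPointProb (p : unitInterval) (X : SimpleGraph V → ℝ) (x : ℝ) :
    bexp p (fun ω => if X (graphOf ω) = x then 1 else 0) ≤
      maxPointProb (SimpleGraph.binomialRandom V p) X := by
  have h : bexp p (fun ω => if X (graphOf ω) = x then 1 else 0) =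
      (SimpleGraph.binomialRandom V p).real {G | X G = x} := by
    rw [← integral_indicator_one (MeasurableSet.of_discrete), integral_binomialRandom]
    congr 1
  rw [h]
  refine le_ciSup (f := fun x => (SimpleGraph.binomialRandom V p).real {G | X G = x})
    ⟨1, ?_⟩ x
  rintro _ ⟨y, rfl⟩
  exact measureReal_le_one

/-- The bounds on the standard deviation and on the point probabilities of a random variable on
`G(n, p)` that is a sum of local statistics. -/
theorem exists_mul_sqrt_div_stdDev_le {p : unitInterval} (h0 : 0 < p) (h1 : p < 1) {k : ℕ}
    (hk : 4 ≤ k) {b : ℝ} (hb : b ≠ 0) (a c K : ℝ)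
    (X : ∀ n, SimpleGraph (Fin n) → ℕ) (g : ∀ n, Finset (Fin n) → (Sym2 (Fin n) → Bool) → ℝ)
    (hg : ∀ n, k ≤ n → IsLocalStat (p : ℝ) k a b c K (g n))
    (hX : ∀ n, k ≤ n → ∀ ω, (X n (graphOf ω) : ℝ) = ∑ S ∈ Finset.univ.powersetCard k, g n S ω) :
    ∃ r : ℝ, 0 < r ∧ ∀ n : ℕ, k ≤ n →
      0 < stdDev (gnp n p) (fun G => (X n G : ℝ)) ∧
      r * ((n : ℝ) ^ (1 / 2 : ℝ) / stdDev (gnp n p) (fun G => (X n G : ℝ))) ≤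
        maxPointProb (gnp n p) (fun G => (X n G : ℝ)) := by
  obtain ⟨r, hr, h⟩ := IsLocalStat.exists_pointProb_ge (p := p) (k := k) (b := b)
    (by exact_mod_cast h0) (by exact_mod_cast h1) hk hb a c K
  refine ⟨r, hr, fun n hn => ?_⟩
  obtain ⟨hv, x, hx⟩ := h n hn (g n) (fun ω => (X n (graphOf ω) : ℤ)) (hg n hn)
    (fun ω => by rw [← hX n hn ω, Int.cast_natCast])
  simp only [Int.cast_natCast] at hv hx
  rw [stdDev_binomialRandom, ← Real.sqrt_eq_rpow]
  refine ⟨Real.sqrt_pos.2 hv, hx.trans ?_⟩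
  refine le_trans (le_of_eq ?_) (bexp_le_maxPointProb p (fun G => (X n G : ℝ)) (x : ℝ))
  congr 1
  ext ω
  norm_cast

end Transfer

/-! ### Subgraph copies of two disjoint edges. -/

section TwoDisjointEdges

lemma edgeSet_twoDisjointEdges : twoDisjointEdges.edgeSet =
    {s(Sum.inl 0, Sum.inl 1), s(Sum.inr 0, Sum.inr 1)} := by
  ext e
  induction e using Sym2.ind with
  | _ x y =>
    rcases x with x | x <;> rcases y with y | y <;> fin_cases x <;> fin_cases y <;> simp

/-- Each copy corresponds to the two orderings of its pair of edges. Conversely a pair determines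
the copy, because there are no isolated vertices and the edge set fixes the subgraph (`hverts`). -/
lemma two_mul_copyCount_twoDisjointEdges {V : Type*} [Fintype V] [DecidableEq V]
    (G : SimpleGraph V) [DecidablePred (· ∈ G.edgeSet)] :
    G.copyCount twoDisjointEdges * 2 =
      ((disjPairs (Finset.univ : Finset V)).filter
        fun q => q.1 ∈ G.edgeSet ∧ q.2 ∈ G.edgeSet).card := by
  classical
  have hinj : ∀ f : SimpleGraph.Copy twoDisjointEdges G, Function.Injective f :=
    fun f => f.injective
  have hedge : ∀ f : SimpleGraph.Copy twoDisjointEdges G, f.toSubgraph.edgeSet =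
      {s(f (Sum.inl 0), f (Sum.inl 1)), s(f (Sum.inr 0), f (Sum.inr 1))} := fun f => by
    rw [SimpleGraph.Copy.toSubgraph, SimpleGraph.Subgraph.edgeSet_map,
      SimpleGraph.Subgraph.edgeSet_top, edgeSet_twoDisjointEdges, Set.image_pair]
    rfl
  have hdisj : ∀ f : SimpleGraph.Copy twoDisjointEdges G,
      Disjoint s(f (Sum.inl 0), f (Sum.inl 1)).toFinset s(f (Sum.inr 0), f (Sum.inr 1)).toFinset :=
    fun f => by
      simp [Sym2.toFinset_mk_eq, (hinj f).eq_iff]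
  have hmem : ∀ f : SimpleGraph.Copy twoDisjointEdges G, ∀ e ∈ f.toSubgraph.edgeSet,
      e ∈ G.edgeSet := fun f e he => f.toSubgraph.edgeSet_subset he
  have hverts : ∀ f : SimpleGraph.Copy twoDisjointEdges G, ∀ v,
      v ∈ f.toSubgraph.verts ↔ ∃ e ∈ f.toSubgraph.edgeSet, v ∈ e := fun f v => by
    rw [hedge]
    simp only [SimpleGraph.Copy.toSubgraph, SimpleGraph.Subgraph.map_verts,
      SimpleGraph.Subgraph.verts_top, Set.image_univ, Set.mem_range, Sum.exists, Fin.exists_fin_two,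
      Set.mem_insert_iff, Set.mem_singleton_iff, exists_eq_or_imp, exists_eq_left, Sym2.mem_iff,
      SimpleGraph.Copy.coe_toHom, eq_comm]
  rw [SimpleGraph.copyCount_eq_card_image_copyToSubgraph, ← mul_one (Finset.card _)]
  rw [mul_one]
  conv_rhs => rw [← mul_one (Finset.card _)]
  refine Finset.card_mul_eq_card_mul
    (fun (G' : G.Subgraph) (q : Sym2 V × Sym2 V) => G'.edgeSet = {q.1, q.2}) ?_ ?_
  · simp only [Finset.mem_image, Finset.mem_univ, true_and, forall_exists_index,
      forall_apply_eq_imp_iff]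
    intro f
    set e := s(f (Sum.inl 0), f (Sum.inl 1))
    set e' := s(f (Sum.inr 0), f (Sum.inr 1))
    have hee : e ≠ e' := ne_of_disjoint_toFinset (hdisj f)
    have : (Finset.bipartiteAbove (fun (G' : G.Subgraph) (q : Sym2 V × Sym2 V) =>
        G'.edgeSet = {q.1, q.2}) ((disjPairs (Finset.univ : Finset V)).filter
        fun q => q.1 ∈ G.edgeSet ∧ q.2 ∈ G.edgeSet) f.toSubgraph) = {(e, e'), (e', e)} := by
      have he : e ∈ G.edgeSet := hmem f e (by rw [hedge]; simp [e])
      have he' : e' ∈ G.edgeSet := hmem f e' (by rw [hedge]; simp [e'])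
      ext ⟨q, r⟩
      simp only [Finset.mem_bipartiteAbove, Finset.mem_filter, mem_disjPairs, mem_edgesIn,
        Finset.subset_univ, true_and, hedge, Set.pair_eq_pair_iff, Finset.mem_insert,
        Finset.mem_singleton, Prod.mk.injEq]
      constructor
      · rintro ⟨-, ⟨h1, h2⟩ | ⟨h1, h2⟩⟩
        · exact Or.inl ⟨h1.symm, h2.symm⟩
        · exact Or.inr ⟨h2.symm, h1.symm⟩
      · have d := G.not_isDiag_of_mem_edgeSet he
        have d' := G.not_isDiag_of_mem_edgeSet he'
        rintro (⟨rfl, rfl⟩ | ⟨rfl, rfl⟩)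
        · exact ⟨⟨⟨⟨d, d'⟩, hdisj f⟩, he, he'⟩, Or.inl ⟨rfl, rfl⟩⟩
        · exact ⟨⟨⟨⟨d', d⟩, (hdisj f).symm⟩, he', he⟩, Or.inr ⟨rfl, rfl⟩⟩
    rw [this, Finset.card_pair]
    simp [hee]
  · rintro ⟨q, r⟩ h
    induction q using Sym2.ind with
    | _ a b =>
    induction r using Sym2.ind with
    | _ c d =>
    simp only [Finset.mem_filter, mem_disjPairs, SimpleGraph.mem_edgeSet, Sym2.toFinset_mk_eq,
      Finset.disjoint_insert_left, Finset.disjoint_singleton_left, Finset.mem_insert,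
      Finset.mem_singleton, not_or] at h
    obtain ⟨⟨-, ⟨hac, had⟩, hbc, hbd⟩, hab, hcd⟩ := h
    have hab' := hab.ne
    have hcd' := hcd.ne
    let φ : twoDisjointEdges →g G :=
      { toFun := Sum.elim ![a, b] ![c, d]
        map_rel' := by
          rintro (x | x) (y | y) <;> fin_cases x <;> fin_cases y <;>
            simp [hab, hcd, hab.symm, hcd.symm] }
    have hφ : Function.Injective φ := by
      rintro (x | x) (y | y) <;> fin_cases x <;> fin_cases y <;>
        simp [φ, hab', hcd', hab'.symm, hcd'.symm, hac, had, hbc, hbd, Ne.symm hac, Ne.symm had,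
          Ne.symm hbc, Ne.symm hbd]
    rw [Finset.card_eq_one]
    refine ⟨(φ.toCopy hφ).toSubgraph, ?_⟩
    have hφe : (φ.toCopy hφ).toSubgraph.edgeSet = {s(a, b), s(c, d)} := hedge (φ.toCopy hφ)
    ext G'
    simp only [Finset.mem_bipartiteBelow, Finset.mem_image, Finset.mem_univ, true_and,
      Finset.mem_singleton]
    constructor
    · rintro ⟨⟨f, rfl⟩, hf⟩
      have heq : f.toSubgraph.edgeSet = (φ.toCopy hφ).toSubgraph.edgeSet := hf.trans hφe.symm
      refine SimpleGraph.Subgraph.ext ?_ ?_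
      · ext v
        rw [hverts, hverts, heq]
      · ext x y
        rw [← SimpleGraph.Subgraph.mem_edgeSet, ← SimpleGraph.Subgraph.mem_edgeSet, heq]
    · rintro rfl
      exact ⟨⟨_, rfl⟩, hφe⟩

/-- The number of pairs of disjoint edges of a graph inside `S`. -/
noncomputable def matchingCount {V : Type*} [DecidableEq V] (S : Finset V) (ω : Sym2 V → Bool) :
    ℝ :=
  (∑ q ∈ disjPairs S, (cond (ω q.1) 1 0 : ℝ) * cond (ω q.2) 1 0) / 2

variable {V : Type*} [Fintype V] [DecidableEq V]

lemma copyCount_graphOf_twoDisjointEdges (ω : Sym2 V → Bool) :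
    ((graphOf ω).copyCount twoDisjointEdges : ℝ) =
      ∑ S ∈ Finset.univ.powersetCard 4, matchingCount S ω := by
  classical
  have h := two_mul_copyCount_twoDisjointEdges (graphOf ω)
  rw [Finset.card_filter] at h
  have h' : ((graphOf ω).copyCount twoDisjointEdges : ℝ) * 2 =
      ∑ q ∈ disjPairs (Finset.univ : Finset V), (cond (ω q.1) 1 0 : ℝ) * cond (ω q.2) 1 0 := by
    have := congrArg (Nat.cast (R := ℝ)) h
    push_cast at this
    rw [this]
    refine Finset.sum_congr rfl fun q hq => ?_
    rw [mem_disjPairs, mem_edgesIn, mem_edgesIn] at hq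
    have e : ∀ e : Sym2 V, ¬ e.IsDiag → (e ∈ (graphOf ω).edgeSet ↔ ω e = true) := fun e he => by
      simp [graphOf, he]
    simp only [e q.1 hq.1.1.2, e q.2 hq.1.2.2]
    cases ω q.1 <;> cases ω q.2 <;> simp
  simp only [matchingCount, ← Finset.sum_div, sum_powersetCard_sum_disjPairs le_rfl, ← h']
  simp

/-- In a `4`-set each edge has exactly one disjoint partner, the complementary pair. -/
lemma sum_disjPairs_fst {V : Type*} [DecidableEq V] {S : Finset V} (hS : S.card = 4)
    (F : Sym2 V → ℝ) : ∑ q ∈ disjPairs S, F q.1 = ∑ e ∈ edgesIn S, F e := by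
  rw [disjPairs, Finset.sum_filter, Finset.sum_product]
  refine Finset.sum_congr rfl fun e he => ?_
  simp only
  rw [← Finset.sum_filter, Finset.sum_const]
  have : (edgesIn S).filter (fun f => Disjoint e.toFinset f.toFinset) =
      edgesIn (S \ e.toFinset) := by
    ext f
    simp only [Finset.mem_filter, mem_edgesIn, Finset.subset_sdiff, disjoint_comm]
    tauto
  rw [mem_edgesIn] at he
  rw [this, card_edgesIn, Finset.card_sdiff_of_subset he.1,
    Sym2.card_toFinset_of_not_isDiag e he.2, hS]
  simp

lemma sum_disjPairs_snd {V : Type*} [DecidableEq V] {S : Finset V} (hS : S.card = 4)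
    (F : Sym2 V → ℝ) : ∑ q ∈ disjPairs S, F q.2 = ∑ e ∈ edgesIn S, F e := by
  rw [← sum_disjPairs_fst hS F]
  refine Finset.sum_nbij' Prod.swap Prod.swap ?_ ?_ ?_ ?_ ?_ <;>
    simp +contextual [mem_disjPairs, disjoint_comm]

lemma matchingCount_eq {V : Type*} [DecidableEq V] (p : ℝ) {S : Finset V} (hS : S.card = 4)
    (ω : Sym2 V → Bool) :
    matchingCount S ω = 3 * p ^ 2 + p * linSum p S ω + 1 / 2 * disjSum p S ω := by
  have h1 : ∑ q ∈ disjPairs S, (p ^ 2 + p * centred p ω q.1 + p * centred p ω q.2 +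
      centred p ω q.1 * centred p ω q.2) = 6 * p ^ 2 + 2 * (p * linSum p S ω) + disjSum p S ω := by
    rw [Finset.sum_add_distrib, Finset.sum_add_distrib, Finset.sum_add_distrib,
      sum_disjPairs_fst hS (fun _ => p ^ 2), sum_disjPairs_fst hS (fun e => p * centred p ω e),
      sum_disjPairs_snd hS (fun e => p * centred p ω e), Finset.sum_const, card_edgesIn, hS,
      ← Finset.mul_sum, linSum, disjSum]
    norm_num [Nat.choose]
    ring
  have h2 : ∑ q ∈ disjPairs S, (cond (ω q.1) 1 0 : ℝ) * cond (ω q.2) 1 0 =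
      ∑ q ∈ disjPairs S, (p ^ 2 + p * centred p ω q.1 + p * centred p ω q.2 +
      centred p ω q.1 * centred p ω q.2) := by
    refine Finset.sum_congr rfl fun q _ => ?_
    simp only [centred]
    ring
  rw [matchingCount, h2, h1]
  ring

/-- Here `k = 4`, so the only `4`-subset is `S` itself, nothing is resampled, and `matchingCount_eq`
is already the required expansion. -/
lemma isLocalStat_matchingCount {p : ℝ} (h0 : 0 ≤ p) (h1 : p ≤ 1) :
    IsLocalStat p 4 (3 * p ^ 2) p (1 / 2)
      (|3 * p ^ 2| + |p| * 16 + |(1 : ℝ) / 2| * 256) (matchingCount (V := V)) where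
  dependsOn S hS ω ω' h := by
    rw [matchingCount_eq p hS, matchingCount_eq p hS, dependsOn_linSum p S ω ω' h,
      dependsOn_disjSum p S ω ω' h]
  abs_le S hS ω := by
    rw [matchingCount_eq p hS]
    have e1 := abs_linSum_le h0 h1 S ω
    have e2 := abs_disjSum_le h0 h1 S ω
    rw [hS] at e1 e2
    norm_num at e1 e2
    refine (abs_add_three _ _ _).trans ?_
    rw [abs_mul p, abs_mul (1 / 2)]
    gcongr
  average S hS U hU hU4 ω := by
    obtain rfl : U = S := Finset.eq_of_subset_of_card_le hU (by omega)
    have h : ∀ η, matchingCount U ((edgesIn U).piecewise ω η) = matchingCount U ω := fun η => by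
      rw [matchingCount_eq p hS, matchingCount_eq p hS, (dependsOn_linSum p U).piecewise,
        (dependsOn_disjSum p U).piecewise]
    simp only [h, bexp_const]
    exact matchingCount_eq p hS ω

theorem exists_twoEdgesCount_pointProb {p : unitInterval} (h0 : 0 < p) (h1 : p < 1) :
    ∃ c : ℝ, 0 < c ∧ ∀ n : ℕ, 4 ≤ n →
      0 < stdDev (gnp n p) (twoEdgesCount n) ∧
      c * ((n : ℝ) ^ (1 / 2 : ℝ) / stdDev (gnp n p) (twoEdgesCount n)) ≤
        maxPointProb (gnp n p) (twoEdgesCount n) := by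
  have hp0 : (0 : ℝ) < p := by exact_mod_cast h0
  exact exists_mul_sqrt_div_stdDev_le h0 h1 le_rfl hp0.ne' _ _ _
    (fun n G => G.copyCount twoDisjointEdges) (fun n => matchingCount)
    (fun n _ => isLocalStat_matchingCount hp0.le p.2.2)
    (fun n _ ω => copyCount_graphOf_twoDisjointEdges ω)

end TwoDisjointEdges

/-! ### Induced copies at edge probability one half, and four-vertex patterns. -/

section InducedCopies

lemma edgesIn_map {V W : Type*} [DecidableEq V] [DecidableEq W] (u : W ↪ V) (S : Finset W) :
    edgesIn (S.map u) = (edgesIn S).map (Function.Embedding.sym2Map u) := by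
  rw [edgesIn, edgesIn, Finset.sym2_map, Finset.filter_map]
  congr 1
  refine Finset.filter_congr fun e _ => ?_
  simp [Sym2.isDiag_map u.injective]

lemma toFinset_sym2_map {V W : Type*} [DecidableEq V] [DecidableEq W] (u : W ↪ V) (e : Sym2 W) :
    (e.map u).toFinset = e.toFinset.map u := by
  ext v
  simp [Sym2.mem_toFinset, Sym2.mem_map]

lemma disjPairs_map {V W : Type*} [DecidableEq V] [DecidableEq W] (u : W ↪ V) (S : Finset W) :
    disjPairs (S.map u) = (disjPairs S).map
      ((Function.Embedding.sym2Map u).prodMap (Function.Embedding.sym2Map u)) := by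
  rw [disjPairs, disjPairs, edgesIn_map, ← Finset.prodMap_map_product, Finset.filter_map]
  congr 1
  refine Finset.filter_congr fun q _ => ?_
  simp [toFinset_sym2_map]

lemma linSum_map {V W : Type*} [DecidableEq V] [DecidableEq W] (p : ℝ) (u : W ↪ V) (S : Finset W)
    (ω : Sym2 V → Bool) : linSum p (S.map u) ω = linSum p S (fun e => ω (e.map u)) := by
  rw [linSum, edgesIn_map, Finset.sum_map]
  rfl

lemma disjSum_map {V W : Type*} [DecidableEq V] [DecidableEq W] (p : ℝ) (u : W ↪ V) (S : Finset W)
    (ω : Sym2 V → Bool) : disjSum p (S.map u) ω = disjSum p S (fun e => ω (e.map u)) := by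
  rw [disjSum, disjPairs_map, Finset.sum_map]
  rfl

open scoped Classical in
/-- The number of injections of `Fin 4` into the vertices of `H` that induce the pattern `J`. -/
noncomputable def patternCount {W : Type*} [Fintype W] (H : SimpleGraph W)
    (J : Sym2 (Fin 4) → Bool) : ℕ :=
  (Finset.univ.filter fun w : Fin 4 ↪ W =>
    ∀ e ∈ edgesIn Finset.univ, (e.map w ∈ H.edgeSet ↔ J e = true)).card

section Matching

variable {V W : Type*} [Fintype W] [DecidableEq W]

open scoped Classical in
/-- The indicator of the event that the graph induced on `S` is isomorphic to `H`. -/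
noncomputable def inducedIndicator {V W : Type*} (H : SimpleGraph W) (S : Finset V)
    (ω : Sym2 V → Bool) : ℝ :=
  if Nonempty (H ≃g (graphOf ω).induce (S : Set V)) then 1 else 0

/-- The bijection `φ` maps the edges of `H` to the coordinates with value `true`. -/
def MatchesPattern (H : SimpleGraph W) {S : Finset V} (φ : W ≃ S) (ω : Sym2 V → Bool) : Prop :=
  ∀ e ∈ edgesIn (Finset.univ : Finset W),
    (e ∈ H.edgeSet ↔ ω (e.map fun w => (φ w : V)) = true)

lemma matchesPattern_iff (H : SimpleGraph W) {S : Finset V} (φ : W ≃ S) (ω : Sym2 V → Bool) :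
    MatchesPattern H φ ω ↔
      ∀ a b, ((graphOf ω).induce (S : Set V)).Adj (φ a) (φ b) ↔ H.Adj a b := by
  simp only [SimpleGraph.comap_adj, Function.Embedding.subtype_apply, graphOf_adj]
  constructor
  · intro h a b
    by_cases hab : a = b
    · simp [hab]
    · have := h s(a, b) (by simp [mem_edgesIn, hab])
      rw [SimpleGraph.mem_edgeSet, Sym2.map_mk] at this
      rw [this]
      simp [hab, Subtype.val_injective.eq_iff]
  · intro h e he
    induction e using Sym2.ind with
    | _ a b =>
      have hab : a ≠ b := by simpa using (mem_edgesIn.1 he).2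
      rw [SimpleGraph.mem_edgeSet, ← h a b, Sym2.map_mk]
      simp [hab, Subtype.val_injective.eq_iff]

-- If an isomorphism exists, composing with it identifies all isomorphisms with the automorphisms of
-- `H`; hence the factor.
open scoped Classical in
lemma sum_matchesPattern (H : SimpleGraph W) (S : Finset V) (ω : Sym2 V → Bool) :
    ∑ φ : W ≃ S, (if MatchesPattern H φ ω then (1 : ℝ) else 0) =
      Nat.card (H ≃g H) * inducedIndicator H S ω := by
  have e1 : ∑ φ : W ≃ S, (if MatchesPattern H φ ω then (1 : ℝ) else 0) =
      Nat.card (H ≃g (graphOf ω).induce (S : Set V)) := by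
    rw [Finset.sum_boole, ← Fintype.card_subtype, ← Nat.card_eq_fintype_card]
    congr 1
    exact Nat.card_congr
      { toFun := fun φ => ⟨φ.1, fun {a b} => (matchesPattern_iff H φ.1 ω).1 φ.2 a b⟩
        invFun := fun f => ⟨f.toEquiv, (matchesPattern_iff H f.toEquiv ω).2 fun a b =>
          f.map_rel_iff⟩
        left_inv := fun φ => rfl
        right_inv := fun f => rfl }
  rw [e1, inducedIndicator]
  split_ifs with h
  · obtain ⟨ψ⟩ := h
    rw [mul_one]
    congr 1
    exact Nat.card_congr
      { toFun := fun f => f.trans ψ.symm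
        invFun := fun f => f.trans ψ
        left_inv := fun f => by ext; simp
        right_inv := fun f => by ext; simp }
  · rw [not_nonempty_iff] at h
    simp

open scoped Classical in
/-- Averaging over the bijections `W ≃ S` is the same as averaging over injections of `Fin 4`. -/
lemma sum_equiv_comp {S : Finset V} (hS : S.card = Fintype.card W) (u : Fin 4 → S)
    (hu : Function.Injective u) (P : (Fin 4 → W) → Prop) :
    ∑ φ : W ≃ S, (if P (fun i => φ.symm (u i)) then (1 : ℝ) else 0) =
      ((Fintype.card W).factorial / Fintype.card (Fin 4 ↪ W)) *
        ((Finset.univ.filter fun w : Fin 4 ↪ W => P w).card : ℝ) := by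
  obtain ⟨φ₀⟩ : Nonempty (W ≃ S) := Fintype.card_eq.1 (by rw [Fintype.card_coe, hS])
  set w₀ : Fin 4 ↪ W := ⟨fun i => φ₀.symm (u i), φ₀.symm.injective.comp hu⟩
  set T : (Fin 4 ↪ W) → ℕ := fun w =>
    (Finset.univ.filter fun φ : W ≃ S => ∀ i, φ.symm (u i) = w i).card with hT
  -- A permutation of `W` carrying `w` to `w₀` matches the two fibres, so every injection arises
  -- from equally many bijections.
  have hconst : ∀ w, T w = T w₀ := fun w => by
    obtain ⟨σ, hσ⟩ := Equiv.Perm.exists_extending_pair w w₀ w.injective w₀.injective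
    refine Finset.card_bij' (fun φ _ => σ.symm.trans φ) (fun φ _ => σ.trans φ) ?_ ?_ ?_ ?_
    · intro φ hφ
      simp only [Finset.mem_filter, Finset.mem_univ, true_and] at hφ ⊢
      intro i
      simp [hφ i, hσ]
    · intro φ hφ
      simp only [Finset.mem_filter, Finset.mem_univ, true_and] at hφ ⊢
      intro i
      simp [hφ i, ← hσ]
    · intro φ _; ext; simp
    · intro φ _; ext; simp
  have hsum : ∀ Q : (Fin 4 → W) → Prop,
      ∑ φ : W ≃ S, (if Q (fun i => φ.symm (u i)) then (1 : ℝ) else 0) =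
        T w₀ * ((Finset.univ.filter fun w : Fin 4 ↪ W => Q w).card : ℝ) := fun Q => by
    have e : ∀ φ : W ≃ S, (if Q (fun i => φ.symm (u i)) then (1 : ℝ) else 0) =
        ∑ w : Fin 4 ↪ W, if Q w then (if ∀ i, φ.symm (u i) = w i then 1 else 0) else 0 := by
      intro φ
      rw [Finset.sum_eq_single ⟨fun i => φ.symm (u i), φ.symm.injective.comp hu⟩]
      · simp
      · intro w _ hw
        have : ¬ ∀ i, φ.symm (u i) = w i := fun h => hw (by ext i; simp [h i])
        simp [this]
      · simp
    simp only [e]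
    rw [Finset.sum_comm, mul_comm, ← nsmul_eq_mul, ← Finset.sum_const, Finset.sum_filter]
    refine Finset.sum_congr rfl fun w _ => ?_
    by_cases hQ : Q w
    · simp only [hQ, if_true, Finset.sum_boole]
      exact_mod_cast hconst w
    · simp [hQ]
  -- The trivial predicate determines the common fibre size as `(Fintype.card W)!` over the number
  -- of injections.
  have htrue := hsum fun _ => True
  simp only [if_true, Finset.sum_const, Finset.card_univ, Finset.filter_true, nsmul_eq_mul,
    mul_one, Fintype.card_equiv φ₀] at htrue
  have hne : (Fintype.card (Fin 4 ↪ W) : ℝ) ≠ 0 := by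
    exact_mod_cast (Fintype.card_pos_iff.2 ⟨w₀⟩).ne'
  rw [hsum P, htrue, mul_div_cancel_right₀ _ hne]

end Matching

variable {V W : Type*} [Fintype V] [DecidableEq V] [Fintype W] [DecidableEq W]

open scoped Classical in
/-- The conditional probability that a given bijection matches the pattern. -/
lemma bexp_matchesPattern (H : SimpleGraph W) {S : Finset V} (φ : W ≃ S) (u : Fin 4 ↪ V)
    (hu : ∀ i, u i ∈ S) (ω : Sym2 V → Bool) :
    bexp (1 / 2) (fun η => if MatchesPattern H φ
        ((edgesIn (Finset.univ.map u)).piecewise ω η) then 1 else 0) =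
      (1 / 2) ^ ((Fintype.card W).choose 2 - 6) *
        (if ∀ e ∈ edgesIn (Finset.univ : Finset (Fin 4)),
          (e.map (fun i => φ.symm ⟨u i, hu i⟩) ∈ H.edgeSet ↔ ω (e.map u) = true)
          then 1 else 0) := by
  set j : W ↪ V := φ.toEmbedding.trans (Function.Embedding.subtype _) with hj
  set w : Fin 4 ↪ W := ⟨fun i => φ.symm ⟨u i, hu i⟩, fun a b h => by
    simpa using φ.symm.injective h⟩ with hw
  have hjw : ∀ e : Sym2 (Fin 4), (e.map w).map j = e.map u := fun e => by
    rw [Sym2.map_map]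
    congr 1
    ext i
    change ((φ (φ.symm ⟨u i, hu i⟩) : S) : V) = u i
    rw [Equiv.apply_symm_apply]
  have hmem : (edgesIn (Finset.univ : Finset W)).filter
      (fun e => e.map j ∈ edgesIn (Finset.univ.map u)) =
        (edgesIn (Finset.univ : Finset (Fin 4))).map (Function.Embedding.sym2Map w) := by
    ext e
    rw [edgesIn_map, Finset.mem_filter, Finset.mem_map, Finset.mem_map]
    constructor
    · rintro ⟨-, e', he', h⟩
      refine ⟨e', he', Sym2.map.injective j.injective ?_⟩
      rw [← h]
      exact hjw e'
    · rintro ⟨e', he', rfl⟩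
      refine ⟨?_, e', he', (hjw e').symm⟩
      have := Finset.mem_map_of_mem (Function.Embedding.sym2Map w) he'
      rw [← edgesIn_map] at this
      exact edgesIn_mono (Finset.subset_univ _) this
  obtain ⟨F, hF⟩ : ∃ F : Sym2 W → Bool → ℝ, F = fun e b =>
      if e.map j ∈ edgesIn (Finset.univ.map u) then
        (if e ∈ H.edgeSet ↔ ω (e.map j) = true then (1 : ℝ) else 0) else
        (if e ∈ H.edgeSet ↔ b = true then 1 else 0) := ⟨_, rfl⟩
  have hprod : ∀ η : Sym2 V → Bool, (if MatchesPattern H φ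
      ((edgesIn (Finset.univ.map u)).piecewise ω η) then (1 : ℝ) else 0) =
      ∏ e ∈ edgesIn (Finset.univ : Finset W),
        F e (η (e.map j)) := fun η => by
    have : ∀ e ∈ edgesIn (Finset.univ : Finset W),
        F e (η (e.map j)) =
        if (e ∈ H.edgeSet ↔ (edgesIn (Finset.univ.map u)).piecewise ω η (e.map j) = true)
          then 1 else 0 := fun e _ => by
      by_cases h : e.map j ∈ edgesIn (Finset.univ.map u) <;> simp [hF, h]
    rw [Finset.prod_congr rfl this, Finset.prod_ite_zero]
    simp only [Finset.prod_const_one]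
    exact if_congr Iff.rfl rfl rfl
  rw [funext hprod, bexp_prod_comp (1 / 2) (edgesIn Finset.univ) (Sym2.map j)
    (Sym2.map.injective j.injective).injOn]
  -- Here `p = 1 / 2` is essential: a resampled pair agrees with `H` with probability `1 / 2`
  -- whether or not `H` has that edge. Only the six pairs inside the fixed `4`-set depend on the
  -- pattern.
  have hfac : ∀ e ∈ edgesIn (Finset.univ : Finset W),
      (1 / 2 * F e true + (1 - 1 / 2) * F e false) =
      if e.map j ∈ edgesIn (Finset.univ.map u) then
          (if e ∈ H.edgeSet ↔ ω (e.map j) = true then (1 : ℝ) else 0) else 1 / 2 := fun e _ => by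
    by_cases h : e.map j ∈ edgesIn (Finset.univ.map u)
    · simp only [hF, h, if_true]
      ring
    · by_cases h' : e ∈ H.edgeSet <;> norm_num [hF, h, h']
  rw [Finset.prod_congr rfl hfac, Finset.prod_ite, Finset.prod_const, mul_comm, hmem,
    Finset.prod_map]
  congr 1
  · congr 1
    have := Finset.card_filter_add_card_filter_not (s := edgesIn (Finset.univ : Finset W))
      (fun e => e.map j ∈ edgesIn (Finset.univ.map u))
    rw [hmem, Finset.card_map, card_edgesIn, card_edgesIn, Finset.card_univ, Finset.card_univ,
      Fintype.card_fin] at this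
    norm_num [Nat.choose] at this
    omega
  · rw [Finset.prod_ite_zero]
    simp only [Finset.prod_const_one, Function.Embedding.sym2Map_apply, hjw]
    rfl

/-- If the numbers of the patterns on four vertices in `H` depend only on the centred numbers of
edges and pairs of disjoint edges, then being an induced copy of `H` is a local statistic. -/
lemma isLocalStat_inducedIndicator (H : SimpleGraph W) (hW : 4 ≤ Fintype.card W) {α β γ : ℝ}
    (hH : ∀ J : Sym2 (Fin 4) → Bool, (patternCount H J : ℝ) =
      α + β * linSum (1 / 2) Finset.univ J + γ * disjSum (1 / 2) Finset.univ J) :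
    ∃ κ : ℝ, 0 < κ ∧ ∀ (V : Type) [Fintype V] [DecidableEq V],
      IsLocalStat (1 / 2) (Fintype.card W) (κ * α) (κ * β) (κ * γ) 1
        (inducedIndicator (V := V) H) := by
  classical
  have hA : (0 : ℝ) < Nat.card (H ≃g H) := by
    have : Finite (H ≃g H) := Finite.of_injective (fun f => (f : W → W)) DFunLike.coe_injective
    exact_mod_cast Nat.card_pos_iff.2 ⟨⟨SimpleGraph.Iso.refl⟩, this⟩
  have hE : (0 : ℝ) < Fintype.card (Fin 4 ↪ W) := by
    have : Nonempty (Fin 4 ↪ W) := Function.Embedding.nonempty_of_card_le (by simpa using hW)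
    exact_mod_cast Fintype.card_pos
  refine ⟨(1 / 2) ^ ((Fintype.card W).choose 2 - 6) *
    ((Fintype.card W).factorial / Fintype.card (Fin 4 ↪ W)) / Nat.card (H ≃g H), by positivity, ?_⟩
  intro V _ _
  refine ⟨fun S hS ω ω' h => ?_, fun S hS ω => ?_, fun S hS U hUS hU ω => ?_⟩
  · have : (graphOf ω).induce (S : Set V) = (graphOf ω').induce (S : Set V) := by
      ext a b
      simp only [SimpleGraph.comap_adj, Function.Embedding.subtype_apply, graphOf_adj]
      by_cases hab : (a : V) = b
      · simp [hab]
      · rw [h s(↑a, ↑b)]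
        have ha : (a : V) ∈ S := a.2
        have hb : (b : V) ∈ S := b.2
        simp [mem_edgesIn, Sym2.toFinset_mk_eq, Finset.insert_subset_iff, ha, hb, hab]
    rw [inducedIndicator, inducedIndicator, this]
  · rw [inducedIndicator]
    split_ifs <;> simp
  · set u : Fin 4 ↪ V := (U.equivFinOfCardEq hU).symm.toEmbedding.trans
      (Function.Embedding.subtype _) with hu
    have huU : Finset.univ.map u = U := by
      ext v
      simp only [hu, Finset.mem_map, Finset.mem_univ, true_and]
      constructor
      · rintro ⟨i, rfl⟩
        exact ((U.equivFinOfCardEq hU).symm i).2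
      · intro hv
        exact ⟨U.equivFinOfCardEq hU ⟨v, hv⟩, by simp⟩
    have huS : ∀ i, u i ∈ S := fun i => hUS (by
      rw [← huU]; exact Finset.mem_map_of_mem u (Finset.mem_univ i))
    -- Summing over bijections counts each induced copy once per automorphism, and the preimages of
    -- the four fixed vertices run uniformly over injections into `W`; so the conditional
    -- probability is proportional to `patternCount`.
    have key : Nat.card (H ≃g H) *
        bexp (1 / 2) (fun η => inducedIndicator H S ((edgesIn U).piecewise ω η)) =
        (1 / 2) ^ ((Fintype.card W).choose 2 - 6) *
          (((Fintype.card W).factorial / Fintype.card (Fin 4 ↪ W)) *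
            (patternCount H (fun e => ω (e.map u)) : ℝ)) := by
      rw [← bexp_const_mul]
      simp only [← sum_matchesPattern]
      rw [bexp_sum]
      rw [← huU]
      simp only [bexp_matchesPattern H _ u huS]
      rw [← Finset.mul_sum]
      congr 1
      convert! sum_equiv_comp hS (fun i => ⟨u i, huS i⟩)
        (fun i i' h => u.injective (by simpa using h))
        (fun w => ∀ e ∈ edgesIn (Finset.univ : Finset (Fin 4)),
          (e.map w ∈ H.edgeSet ↔ ω (e.map u) = true))
      rw [patternCount]
      congr!
    rw [hH, ← linSum_map (1 / 2) u, ← disjSum_map (1 / 2) u, huU] at key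
    rw [← mul_right_inj' hA.ne', key]
    field_simp

lemma inducedCopyCount_eq {V W : Type*} [Fintype V] [Fintype W] (H : SimpleGraph W)
    (ω : Sym2 V → Bool) :
    (inducedCopyCount (graphOf ω) H : ℝ) =
      ∑ S ∈ Finset.univ.powersetCard (Fintype.card W), inducedIndicator H S ω := by
  classical
  simp only [inducedIndicator, Finset.sum_boole]
  rw [inducedCopyCount]
  congr 2
  ext S
  simp only [Finset.mem_filter, Finset.mem_univ, true_and, Finset.mem_powersetCard,
    Finset.subset_univ, iff_and_self]
  rintro ⟨f⟩
  rw [Fintype.card_congr f.toEquiv]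
  simp

theorem exists_inducedCount_pointProb {k : ℕ} (hk : 4 ≤ k) (H : SimpleGraph (Fin k)) {α β γ : ℝ}
    (hβ : β ≠ 0) (hH : ∀ J : Sym2 (Fin 4) → Bool, (patternCount H J : ℝ) =
      α + β * linSum (1 / 2) Finset.univ J + γ * disjSum (1 / 2) Finset.univ J) :
    ∃ c : ℝ, 0 < c ∧ ∀ n : ℕ, k ≤ n →
      0 < stdDev (gnp n halfProb) (inducedCount H n) ∧
      c * ((n : ℝ) ^ (1 / 2 : ℝ) / stdDev (gnp n halfProb) (inducedCount H n)) ≤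
        maxPointProb (gnp n halfProb) (inducedCount H n) := by
  obtain ⟨κ, hκ, h⟩ := isLocalStat_inducedIndicator H (by simpa using hk) hH
  rw [Fintype.card_fin] at h
  have hp : (halfProb : ℝ) = 1 / 2 := rfl
  have h0 : (0 : unitInterval) < halfProb := by
    rw [← Subtype.coe_lt_coe, hp]; norm_num
  have h1 : halfProb < (1 : unitInterval) := by
    rw [← Subtype.coe_lt_coe, hp]; norm_num
  exact exists_mul_sqrt_div_stdDev_le h0 h1 hk (mul_ne_zero hκ.ne' hβ) _ _ _
    (fun n G => inducedCopyCount G H) (fun n => inducedIndicator H)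
    (fun n _ => by rw [hp]; exact h (Fin n))
    (fun n _ ω => by rw [inducedCopyCount_eq, Fintype.card_fin])

end InducedCopies

/-! ### Kernel-checked counts of four-vertex codes in the explicit graph. -/

section Certificate

/-- Row `a` of the lower triangle of the adjacency matrix of `balancedGraph`: the decimal digit of
weight `10 ^ b` tells whether `a` and `b` are adjacent. -/
@[irreducible] def adjRow (a : ℕ) : ℕ := List.getD [
  0,
  0,
  0,
  0,
  1010,
  110,
  110100,
  1101101,
  100111,
  1001101,
  1110011011,
  110010101,
  111110100000,
  111011100100,
  1011001110010,
  111011001000,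
  1011011010011111,
  1110000110100000,
  11000101110010001,
  10100001110111111,
  1001011110001000,
  111010010100000101000,
  1010101011010001001011,
  11100010101000100011,
  11011011010001101001110,
  1010000010010101111000110,
  11001001101001110111000111,
  1000011001000111100111110,
  110111100000110100101010,
  10101011110101101101011101110,
  101101010100010111000000110,
  1000111001100111110100010011110,
  10001101100010000101000100001010,
  110001111011000111101011000110111,
  1011101011100001110001001010011100,
  10101000101101101110101111110011000,
  101001011110011000001011011000101001,
  1111101000110010010000111101000010001,
  1100010000101010001101010111011011011,
  11010011010010111100110010000010111100,
  1011011110110110000010011000011101110101,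
  10101100111110100000000101100101100000001,
  101011011101110100101000011101000100001011,
  1011101100100011100000101010100110010110,
  10000011110111000101010010100011111001010001,
  110110000101110000101010011100110000011001,
  1000110011111110110011101101101000100110010001,
  11110110100011001101111110000101010100110011,
  100010000100011111100100011111101110100000011,
  1000011011000100011011001101101111101110000000010,
  11100011110000011010001100010111011110000010000110,
  1010011010101000011100110100111011001100000000110,
  1100110111100101000101100011001110011000010011111000,
  1010110010110001101000001100110010000111001101110100,
  110001101101101111101011011101000010110111011111010011,
  101100101001001010101001011001101001110100111100,
  100001111111000010111100101011000100000000001110100100,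
  101010110001101101000100100110001010100110010101110100010,
  1011011111011110101010010010001110111010111000101111000100,
  1011010011010101011101011111100111001010010000001100010000,
  11001110101010001101011011001101100101001000011010100010000,
  10101111001111110100010110011000011101011100011001011110,
  11010001100001110011001010111011101111100001111000100000100110,
  100100000111011010100000110110100001101101001110000000110001111] a 0

/-- The entry of the lower triangle of the adjacency matrix. -/
def adjBit (a b : ℕ) : ℕ := Nat.mod (Nat.div (adjRow a) (Nat.pow 10 b)) 10

/-- A graph whose four-vertex induced subgraph counts are determined by the numbers of edges and of
pairs of disjoint edges. -/
def balancedGraph : SimpleGraph (Fin 64) where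
  Adj a b := a ≠ b ∧ adjBit (max (a : ℕ) b) (min (a : ℕ) b) = 1
  symm := ⟨fun a b h => ⟨h.1.symm, by rw [max_comm, min_comm]; exact h.2⟩⟩
  loopless := ⟨fun _ h => h.1 rfl⟩

/-- The sum of `f` over the numbers below `n`, in a form that evaluates quickly. -/
def sumBelow (n : ℕ) (f : ℕ → ℕ) : ℕ := Nat.rec 0 (fun i s => Nat.add s (f i)) n

lemma sumBelow_eq (n : ℕ) (f : ℕ → ℕ) : sumBelow n f = ∑ i ∈ Finset.range n, f i := by
  induction n with
  | zero => rfl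
  | succ n ih => rw [Finset.sum_range_succ, ← ih]; rfl

/-- The code of the graph induced on `a > b > c`. -/
def tripleCode (a b c : ℕ) : ℕ :=
  Nat.add (adjBit a b) (Nat.add (Nat.mul 2 (adjBit a c)) (Nat.mul 4 (adjBit b c)))

/-- The code of the graph induced on `a > b > c > d`. -/
def quadCode (a b c d : ℕ) : ℕ :=
  tripleCode a b c + 8 * (adjBit a d + 2 * adjBit b d + 4 * adjBit c d)

/-- The numbers of occurrences of the codes, packed into the digits of one number. -/
def packedCounts : ℕ :=
  sumBelow 64 fun a => sumBelow a fun b => sumBelow b fun c =>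
    Nat.mul (Nat.pow 2 (Nat.mul 24 (tripleCode a b c))) (sumBelow c fun d =>
      -- One decimal digit of the combined rows gives the adjacencies of `d` to `a`, `b`, `c`
      -- together. It has weight `8` in the code, and `192 = 24 * 8` shifts it in base `2 ^ 24`.
      Nat.pow 2 (Nat.mul 192 (Nat.mod (Nat.div (Nat.add (adjRow a) (Nat.add
        (Nat.mul 2 (adjRow b)) (Nat.mul 4 (adjRow c)))) (Nat.pow 10 d)) 10)))

/-- The number of `4`-sets with a given code. -/
@[irreducible] def codeCount (j : ℕ) : ℕ := List.getD [
  11835, 11600, 12168, 11445, 11340, 11776, 11628, 11243, 10258, 9977, 9875, 9452, 10079, 9943,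
  9599, 8971, 10973, 11126, 10950, 10665, 10310, 10570, 10333, 10365, 9518, 9420, 9124, 8794,
  8966, 9221, 8652, 8367, 10824, 10694, 10848, 10646, 10774, 10911, 10764, 10537, 9319, 9061,
  9540, 8829, 9437, 9298, 9446, 8916, 10036, 10190, 10323, 9991, 9443, 9980, 9785, 9447, 8860,
  8646, 8745, 8673, 8185, 8368, 8264, 8053] j 0

-- The number of `4`-sets is below `2 ^ 24`, so no digit overflows and one equality of large numbers
-- certifies all `64` counts.
set_option maxRecDepth 100000 in
lemma packedCounts_eq :
    packedCounts = sumBelow 64 fun j => Nat.mul (codeCount j) (Nat.pow (2 ^ 24) j) := by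
  decide +kernel

lemma codeCount_lt : ∀ i < 64, codeCount i < 2 ^ 24 := by decide +kernel

lemma sum_digits_div_mod {B : ℕ} (hB : 0 < B) (m : ℕ) (f : ℕ → ℕ) (hf : ∀ i < m, f i < B)
    (d : ℕ) (hd : d < m) : (∑ i ∈ Finset.range m, f i * B ^ i) / B ^ d % B = f d := by
  induction m generalizing f d with
  | zero => omega
  | succ m ih =>
    have e : ∑ i ∈ Finset.range (m + 1), f i * B ^ i =
        f 0 + B * ∑ i ∈ Finset.range m, f (i + 1) * B ^ i := by
      rw [Finset.sum_range_succ', Finset.mul_sum, pow_zero, mul_one, add_comm]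
      congr 1
      exact Finset.sum_congr rfl fun i _ => by ring
    rw [e]
    cases d with
    | zero =>
      rw [pow_zero, Nat.div_one, Nat.add_mul_mod_self_left, Nat.mod_eq_of_lt (hf 0 (by omega))]
    | succ d =>
      rw [pow_succ', ← Nat.div_div_eq_div_mul, Nat.add_mul_div_left _ _ hB,
        Nat.div_eq_of_lt (hf 0 (by omega)), zero_add]
      exact ih (fun i => f (i + 1)) (fun i hi => hf _ (by omega)) d (by omega)

lemma adjRow_eq : ∀ a < 64, adjRow a = ∑ d ∈ Finset.range 64, adjBit a d * 10 ^ d := by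
  have h : ∀ a < 64, adjRow a = sumBelow 64 fun d => Nat.mul (adjBit a d) (Nat.pow 10 d) := by
    decide +kernel
  intro a ha
  rw [h a ha, sumBelow_eq]
  rfl

lemma adjBit_le_one : ∀ a < 64, ∀ b < 64, adjBit a b ≤ 1 := by decide +kernel

/-- Every digit of the combination is at most `1 + 2 + 4 = 7 < 10`, so there are no carries. -/
lemma digit_adjRow {a b c d : ℕ} (ha : a < 64) (hb : b < 64) (hc : c < 64) (hd : d < 64) :
    (adjRow a + (2 * adjRow b + 4 * adjRow c)) / 10 ^ d % 10 =
      adjBit a d + 2 * adjBit b d + 4 * adjBit c d := by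
  have e : adjRow a + (2 * adjRow b + 4 * adjRow c) =
      ∑ i ∈ Finset.range 64, (adjBit a i + 2 * adjBit b i + 4 * adjBit c i) * 10 ^ i := by
    rw [adjRow_eq a ha, adjRow_eq b hb, adjRow_eq c hc, Finset.mul_sum, Finset.mul_sum,
      ← Finset.sum_add_distrib, ← Finset.sum_add_distrib]
    exact Finset.sum_congr rfl fun i _ => by ring
  rw [e]
  refine sum_digits_div_mod (by norm_num) 64
    (fun d => adjBit a d + 2 * adjBit b d + 4 * adjBit c d) (fun i hi => ?_) d hd
  have h1 := adjBit_le_one a ha i hi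
  have h2 := adjBit_le_one b hb i hi
  have h3 := adjBit_le_one c hc i hi
  omega

/-- The decreasing quadruples of numbers below `n`. -/
def quads (n : ℕ) : Finset (Σ _ : ℕ, Σ _ : ℕ, Σ _ : ℕ, ℕ) :=
  (Finset.range n).sigma fun a => (Finset.range a).sigma fun b => (Finset.range b).sigma fun c =>
    Finset.range c

lemma packedCounts_eq_sum :
    packedCounts = ∑ t ∈ quads 64, (2 ^ 24) ^ quadCode t.1 t.2.1 t.2.2.1 t.2.2.2 := by
  rw [packedCounts, quads, Finset.sum_sigma, sumBelow_eq]
  refine Finset.sum_congr rfl fun a ha => ?_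
  rw [Finset.sum_sigma, sumBelow_eq]
  refine Finset.sum_congr rfl fun b hb => ?_
  rw [Finset.sum_sigma, sumBelow_eq]
  refine Finset.sum_congr rfl fun c hc => ?_
  rw [sumBelow_eq]
  change 2 ^ (24 * tripleCode a b c) * _ = _
  rw [Finset.mul_sum]
  refine Finset.sum_congr rfl fun d hd => ?_
  rw [Finset.mem_range] at ha hb hc hd
  change 2 ^ (24 * tripleCode a b c) * 2 ^ (192 *
    ((adjRow a + (2 * adjRow b + 4 * adjRow c)) / 10 ^ d % 10)) = _
  rw [digit_adjRow (by omega) (by omega) (by omega) (by omega), ← pow_add, ← pow_mul, quadCode]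
  congr 1
  ring

lemma tripleCode_eq (a b c : ℕ) :
    tripleCode a b c = adjBit a b + (2 * adjBit a c + 4 * adjBit b c) := rfl

lemma mem_quads {n a b c d : ℕ} : ⟨a, b, c, d⟩ ∈ quads n ↔ a < n ∧ b < a ∧ c < b ∧ d < c := by
  simp only [quads, Finset.mem_sigma, Finset.mem_range]

lemma quadCode_lt {n : ℕ} (hn : n ≤ 64) (t : Σ _ : ℕ, Σ _ : ℕ, Σ _ : ℕ, ℕ) (ht : t ∈ quads n) :
    quadCode t.1 t.2.1 t.2.2.1 t.2.2.2 < 64 := by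
  obtain ⟨a, b, c, d⟩ := t
  obtain ⟨ha, hb, hc, hd⟩ := mem_quads.1 ht
  have h1 := adjBit_le_one a (by omega) b (by omega)
  have h2 := adjBit_le_one a (by omega) c (by omega)
  have h3 := adjBit_le_one a (by omega) d (by omega)
  have h4 := adjBit_le_one b (by omega) c (by omega)
  have h5 := adjBit_le_one b (by omega) d (by omega)
  have h6 := adjBit_le_one c (by omega) d (by omega)
  simp only [quadCode, tripleCode_eq]
  omega

lemma card_quads_le : (quads 64).card < 2 ^ 24 := by
  have : (quads 64).card = sumBelow 64 fun a => sumBelow a fun b => sumBelow b fun c => c := by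
    simp only [quads, Finset.card_sigma, sumBelow_eq, Finset.card_range]
  rw [this]
  decide +kernel

/-- Grouping the left sum by the value of `f` writes both sides in base `B`, and digits are unique.
-/
lemma card_filter_eq_of_sum_pow_eq {ι : Type*} {s : Finset ι} {f : ι → ℕ} {c : ℕ → ℕ} {B m : ℕ}
    (hs : s.card < B) (hf : ∀ t ∈ s, f t < m) (hc : ∀ i < m, c i < B)
    (h : ∑ t ∈ s, B ^ f t = ∑ i ∈ Finset.range m, c i * B ^ i) {j : ℕ} (hj : j < m) :
    (s.filter fun t => f t = j).card = c j := by
  have h1 : ∑ t ∈ s, B ^ f t =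
      ∑ i ∈ Finset.range m, (s.filter fun t => f t = i).card * B ^ i := by
    rw [← Finset.sum_fiberwise_of_maps_to (g := f) (t := Finset.range m)
      fun t ht => Finset.mem_range.2 (hf t ht)]
    refine Finset.sum_congr rfl fun i _ => ?_
    rw [← smul_eq_mul, ← Finset.sum_const]
    exact Finset.sum_congr rfl fun t ht => by rw [(Finset.mem_filter.1 ht).2]
  have hB : 0 < B := (Nat.zero_le _).trans_lt hs
  rw [← sum_digits_div_mod hB m c hc j hj, ← h, h1]
  exact (sum_digits_div_mod hB m (fun i => (s.filter fun t => f t = i).card)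
    (fun i _ => (Finset.card_filter_le _ _).trans_lt hs) j hj).symm

lemma card_quads_filter {j : ℕ} (hj : j < 64) :
    ((quads 64).filter fun t => quadCode t.1 t.2.1 t.2.2.1 t.2.2.2 = j).card = codeCount j :=
  card_filter_eq_of_sum_pow_eq card_quads_le (quadCode_lt le_rfl) codeCount_lt
    (packedCounts_eq_sum.symm.trans (packedCounts_eq.trans (sumBelow_eq _ _))) hj

end Certificate

/-! ### From code counts to the affine formula for pattern counts. -/

section FourVertexPatterns

lemma edgesIn_univ_fin_four : edgesIn (Finset.univ : Finset (Fin 4)) =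
    {s(3, 2), s(3, 1), s(2, 1), s(3, 0), s(2, 0), s(1, 0)} := by
  decide

lemma disjPairs_univ_fin_four : disjPairs (Finset.univ : Finset (Fin 4)) =
    {(s(3, 2), s(1, 0)), (s(1, 0), s(3, 2)), (s(3, 1), s(2, 0)), (s(2, 0), s(3, 1)),
      (s(2, 1), s(3, 0)), (s(3, 0), s(2, 1))} := by
  decide

/-- The code of the graph on `3 > 2 > 1 > 0` whose adjacency matrix is `M`. -/
def matrixCode (M : Fin 4 → Fin 4 → Bool) : ℕ :=
  (M 3 2).toNat + 2 * (M 3 1).toNat + 4 * (M 2 1).toNat + 8 * (M 3 0).toNat +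
    16 * (M 2 0).toNat + 32 * (M 1 0).toNat

/-- The symmetric matrix with zero diagonal and the given entries. -/
def symmMatrix (x : Fin 6 → Bool) : Fin 4 → Fin 4 → Bool :=
  ![![false, x 5, x 4, x 3], ![x 5, false, x 2, x 1], ![x 4, x 2, false, x 0],
    ![x 3, x 1, x 0, false]]

/-- A finite check of `64` cases. The pairs `a, f`, `b, e` and `c, d` are the opposite edges;
exclusive or and the terms moved to the left keep the identity in `ℕ` without subtraction. -/
lemma sum_codeCount_matrixCode (a b c d e f : Bool) :
    ∑ π : Equiv.Perm (Fin 4),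
        codeCount (matrixCode fun i j => symmMatrix ![a, b, c, d, e, f] (π i) (π j)) +
      15128 * (a.toNat + b.toNat + c.toNat + d.toNat + e.toNat + f.toNat) +
      260 * ((a ^^ f).toNat + (b ^^ e).toNat + (c ^^ d).toNat) = 284040 := by
  revert a b c d e f
  decide +kernel

-- Sorting writes every injection uniquely as an increasing injection preceded by a permutation.
open scoped Classical in
lemma card_filter_embedding_eq_sum {m : ℕ} {α : Type*} [LinearOrder α]
    [Fintype (Fin m ↪ α)] (P : (Fin m ↪ α) → Prop) [DecidablePred P] :
    (Finset.univ.filter P).card = ∑ π : Equiv.Perm (Fin m),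
      (Finset.univ.filter fun v : Fin m ↪ α =>
        StrictMono v ∧ P (π.symm.toEmbedding.trans v)).card := by
  rw [Finset.card_eq_sum_card_fiberwise (f := fun w : Fin m ↪ α => Tuple.sort w)
    (t := Finset.univ) fun w _ => Finset.mem_coe.2 (Finset.mem_univ _)]
  refine Finset.sum_congr rfl fun π _ => Finset.card_nbij'
    (fun w => π.toEmbedding.trans w) (fun v => π.symm.toEmbedding.trans v) ?_ ?_ ?_ ?_
  · intro w hw
    simp only [Finset.mem_coe, Finset.mem_filter, Finset.mem_univ, true_and] at hw ⊢
    refine ⟨?_, ?_⟩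
    · have h := (Tuple.monotone_sort w).strictMono_of_injective
        (w.injective.comp (Tuple.sort w).injective)
      rw [hw.2] at h
      exact h
    · convert hw.1 using 1
      ext i
      simp
  · intro v hv
    simp only [Finset.mem_coe, Finset.mem_filter, Finset.mem_univ, true_and] at hv ⊢
    refine ⟨hv.2, ?_⟩
    refine ((Tuple.eq_sort_iff).2 ⟨?_, fun i j hij h => ?_⟩).symm
    · convert hv.1.monotone using 1
      ext i
      simp
    · simp only [Function.Embedding.trans_apply, Equiv.coe_toEmbedding,
        Equiv.symm_apply_apply] at h
      exact absurd (v.injective h) hij.ne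
  · intro w _
    ext i
    simp
  · intro v _
    ext i
    simp

lemma forall_edgesIn_comp_perm {m : ℕ} (π : Equiv.Perm (Fin m)) (P : Sym2 (Fin m) → Prop) :
    (∀ e ∈ edgesIn Finset.univ, P (e.map π)) ↔ ∀ e ∈ edgesIn Finset.univ, P e := by
  have hm : ∀ (σ : Equiv.Perm (Fin m)) (e : Sym2 (Fin m)), e ∈ edgesIn Finset.univ →
      e.map σ ∈ edgesIn Finset.univ := fun σ e he => by
    rw [mem_edgesIn, Sym2.isDiag_map σ.injective]
    exact ⟨Finset.subset_univ _, (mem_edgesIn.1 he).2⟩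
  refine ⟨fun h e he => ?_, fun h e he => h _ (hm π e he)⟩
  have := h _ (hm π.symm e he)
  rwa [Sym2.map_map, show (π ∘ π.symm : Fin m → Fin m) = id from funext fun i => by simp,
    Sym2.map_id] at this

lemma balancedGraph_adj_of_lt {a b : Fin 64} (h : b < a) :
    balancedGraph.Adj a b ↔ adjBit a b = 1 := by
  have h' : (b : ℕ) ≤ a := h.le
  change a ≠ b ∧ adjBit (max (a : ℕ) b) (min (a : ℕ) b) = 1 ↔ _
  rw [max_eq_left h', min_eq_right h']
  exact and_iff_right h.ne'

lemma adjBit_eq_toNat_iff {a b : Fin 64} (h : b < a) (x : Bool) :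
    (balancedGraph.Adj a b ↔ x = true) ↔ adjBit a b = x.toNat := by
  rw [balancedGraph_adj_of_lt h]
  have := adjBit_le_one a a.2 b b.2
  cases x
  · simp
    omega
  · simp

/-- Both codes are binary expansions with the six edges in the same positions, so they agree exactly
when all bits do. -/
lemma induces_pattern_iff (J : Sym2 (Fin 4) → Bool) {v : Fin 4 ↪ Fin 64} (hv : StrictMono v) :
    (∀ e ∈ edgesIn Finset.univ, (e.map v ∈ balancedGraph.edgeSet ↔ J e = true)) ↔
      quadCode (v 3) (v 2) (v 1) (v 0) = matrixCode fun i j => J s(i, j) := by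
  have h10 : v 1 > v 0 := hv (by decide)
  have h20 : v 2 > v 0 := hv (by decide)
  have h30 : v 3 > v 0 := hv (by decide)
  have h21 : v 2 > v 1 := hv (by decide)
  have h31 : v 3 > v 1 := hv (by decide)
  have h32 : v 3 > v 2 := hv (by decide)
  simp only [edgesIn_univ_fin_four, Finset.mem_insert, Finset.mem_singleton, forall_eq_or_imp,
    forall_eq, Sym2.map_mk, SimpleGraph.mem_edgeSet, adjBit_eq_toNat_iff h10,
    adjBit_eq_toNat_iff h20, adjBit_eq_toNat_iff h30, adjBit_eq_toNat_iff h21,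
    adjBit_eq_toNat_iff h31, adjBit_eq_toNat_iff h32, quadCode, tripleCode_eq, matrixCode]
  have b10 := adjBit_le_one _ (v 1).2 _ (v 0).2
  have b20 := adjBit_le_one _ (v 2).2 _ (v 0).2
  have b30 := adjBit_le_one _ (v 3).2 _ (v 0).2
  have b21 := adjBit_le_one _ (v 2).2 _ (v 1).2
  have b31 := adjBit_le_one _ (v 3).2 _ (v 1).2
  have b32 := adjBit_le_one _ (v 3).2 _ (v 2).2
  have c10 := Bool.toNat_le (J s(1, 0))
  have c20 := Bool.toNat_le (J s(2, 0))
  have c30 := Bool.toNat_le (J s(3, 0))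
  have c21 := Bool.toNat_le (J s(2, 1))
  have c31 := Bool.toNat_le (J s(3, 1))
  have c32 := Bool.toNat_le (J s(3, 2))
  omega

lemma matrixCode_lt (M : Fin 4 → Fin 4 → Bool) : matrixCode M < 64 := by
  have c10 := Bool.toNat_le (M 1 0)
  have c20 := Bool.toNat_le (M 2 0)
  have c30 := Bool.toNat_le (M 3 0)
  have c21 := Bool.toNat_le (M 2 1)
  have c31 := Bool.toNat_le (M 3 1)
  have c32 := Bool.toNat_le (M 3 2)
  rw [matrixCode]
  omega

open scoped Classical in
lemma card_strictMono_eq_card_quads {n : ℕ} [Fintype (Fin 4 ↪ Fin n)]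
    (P : ℕ → ℕ → ℕ → ℕ → Prop) [∀ a b c d, Decidable (P a b c d)] :
    (Finset.univ.filter fun v : Fin 4 ↪ Fin n => StrictMono v ∧ P (v 3) (v 2) (v 1) (v 0)).card =
      ((quads n).filter fun t => P t.1 t.2.1 t.2.2.1 t.2.2.2).card := by
  refine Finset.card_bij (fun v _ => ⟨v 3, v 2, v 1, v 0⟩) ?_ ?_ ?_
  · intro v hv
    obtain ⟨hm, hP⟩ := (Finset.mem_filter.1 hv).2
    exact Finset.mem_filter.2 ⟨mem_quads.2 ⟨(v 3).2, hm (by decide), hm (by decide),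
      hm (by decide)⟩, hP⟩
  · intro v _ w _ h
    simp only [Sigma.mk.injEq, heq_eq_eq, Fin.val_inj] at h
    ext i
    fin_cases i <;> simp [h]
  · rintro ⟨a, b, c, d⟩ ht
    obtain ⟨ht, hP⟩ := Finset.mem_filter.1 ht
    obtain ⟨ha, hb, hc, hd⟩ := mem_quads.1 ht
    let u : Fin 4 → Fin n := ![⟨d, by omega⟩, ⟨c, by omega⟩, ⟨b, by omega⟩, ⟨a, ha⟩]
    have hu : StrictMono u := by
      rw [Fin.strictMono_iff_lt_succ]
      intro i
      fin_cases i
      exacts [hd, hc, hb]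
    exact ⟨⟨u, hu.injective⟩, Finset.mem_filter.2 ⟨Finset.mem_univ _, hu, hP⟩, rfl⟩

lemma patternCount_balancedGraph (J : Sym2 (Fin 4) → Bool) :
    patternCount balancedGraph J =
      ∑ π : Equiv.Perm (Fin 4), codeCount (matrixCode fun i j => J s(π i, π j)) := by
  classical
  rw [patternCount, card_filter_embedding_eq_sum]
  refine Finset.sum_congr rfl fun π _ => ?_
  rw [← card_quads_filter (matrixCode_lt _), ← card_strictMono_eq_card_quads
    fun a b c d => quadCode a b c d = matrixCode fun i j => J s(π i, π j)]
  refine congrArg Finset.card (Finset.filter_congr fun v _ => and_congr_right fun hv => ?_)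
  rw [← forall_edgesIn_comp_perm π]
  refine Iff.trans ?_ (induces_pattern_iff (fun e => J (e.map π)) hv)
  refine forall₂_congr fun e _ => ?_
  rw [Sym2.map_map, show ⇑(π.symm.toEmbedding.trans v) ∘ ⇑π = v from
    funext fun i => congrArg v (π.symm_apply_apply i)]

/-- Over `ℝ`, exclusive or is `a + b - 2 * a * b`, so the three terms for opposite edges sum to `3 /
2 - disjSum`, while `linSum` is the edge number minus `3`. The constant is `238266 = 284040 - 3 *
15128 - 260 * 3 / 2`. -/
lemma patternCount_balancedGraph_eq (J : Sym2 (Fin 4) → Bool) :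
    (patternCount balancedGraph J : ℝ) = 238266 + (-15128) * linSum (1 / 2) Finset.univ J +
      260 * disjSum (1 / 2) Finset.univ J := by
  have hM : ∀ i j, i ≠ j → J s(i, j) = symmMatrix
      ![J s(3, 2), J s(3, 1), J s(2, 1), J s(3, 0), J s(2, 0), J s(1, 0)] i j := by
    intro i j hij
    fin_cases i <;> fin_cases j <;> first
      | exact absurd rfl hij
      | rfl
      | exact congrArg J Sym2.eq_swap
  have hcode : ∀ π : Equiv.Perm (Fin 4), matrixCode (fun i j => J s(π i, π j)) =
      matrixCode fun i j => symmMatrix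
        ![J s(3, 2), J s(3, 1), J s(2, 1), J s(3, 0), J s(2, 0), J s(1, 0)] (π i) (π j) := by
    intro π
    simp only [matrixCode]
    rw [hM (π 3) (π 2) (π.injective.ne (by decide)), hM (π 3) (π 1) (π.injective.ne (by decide)),
      hM (π 2) (π 1) (π.injective.ne (by decide)), hM (π 3) (π 0) (π.injective.ne (by decide)),
      hM (π 2) (π 0) (π.injective.ne (by decide)), hM (π 1) (π 0) (π.injective.ne (by decide))]
  have h := sum_codeCount_matrixCode (J s(3, 2)) (J s(3, 1)) (J s(2, 1)) (J s(3, 0)) (J s(2, 0))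
    (J s(1, 0))
  rw [← Finset.sum_congr rfl fun π _ => congrArg codeCount (hcode π),
    ← patternCount_balancedGraph] at h
  have hx : ∀ a b : Bool, ((a ^^ b).toNat : ℝ) = a.toNat + b.toNat - 2 * a.toNat * b.toNat := by
    intro a b
    cases a <;> cases b <;> norm_num
  have hc : ∀ b : Bool, (cond b 1 0 : ℝ) = b.toNat := by
    intro b
    cases b <;> simp
  have h' := congrArg (Nat.cast (R := ℝ)) h
  push_cast [hx] at h'
  have e1 : linSum (1 / 2) Finset.univ J = ((J s(3, 2)).toNat + (J s(3, 1)).toNat +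
      (J s(2, 1)).toNat + (J s(3, 0)).toNat + (J s(2, 0)).toNat + (J s(1, 0)).toNat : ℝ) - 3 := by
    rw [linSum, edgesIn_univ_fin_four]
    repeat rw [Finset.sum_insert (by decide)]
    rw [Finset.sum_singleton]
    simp only [centred, hc]
    ring
  have e2 : disjSum (1 / 2) Finset.univ J = 2 * (((J s(3, 2)).toNat - 1 / 2 : ℝ) *
      ((J s(1, 0)).toNat - 1 / 2) + ((J s(3, 1)).toNat - 1 / 2 : ℝ) *
      ((J s(2, 0)).toNat - 1 / 2) + ((J s(2, 1)).toNat - 1 / 2 : ℝ) *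
      ((J s(3, 0)).toNat - 1 / 2)) := by
    rw [disjSum, disjPairs_univ_fin_four]
    repeat rw [Finset.sum_insert (by decide)]
    rw [Finset.sum_singleton]
    simp only [centred, hc]
    ring
  rw [e1, e2]
  linear_combination h'

end FourVertexPatterns

theorem theorem1p3 :
    (∀ p : unitInterval, 0 < p → p < 1 →
      ∃ c : ℝ, 0 < c ∧ ∀ n : ℕ, 4 ≤ n →
        0 < stdDev (gnp n p) (twoEdgesCount n) ∧
        c * ((n : ℝ) ^ (1 / 2 : ℝ) / stdDev (gnp n p) (twoEdgesCount n)) ≤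
          maxPointProb (gnp n p) (twoEdgesCount n)) ∧
    (∃ H' : SimpleGraph (Fin 64),
      ∃ c : ℝ, 0 < c ∧ ∀ n : ℕ, 64 ≤ n →
        0 < stdDev (gnp n halfProb) (inducedCount H' n) ∧
        c * ((n : ℝ) ^ (1 / 2 : ℝ) / stdDev (gnp n halfProb) (inducedCount H' n)) ≤
          maxPointProb (gnp n halfProb) (inducedCount H' n)) :=
  ⟨fun _ h0 h1 => exists_twoEdgesCount_pointProb h0 h1, balancedGraph,
    exists_inducedCount_pointProb (by norm_num) balancedGraph (by norm_num)
      patternCount_balancedGraph_eq⟩
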